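/- **Proposition (Limit theorems).** Let $(\mathcal X,d)$ and $\mathcal Z$ be Polish metric spaces, let $S:\mathcal X\times\mathcal Z\to\mathcal X$ be locally Lipschitz, and let $(\xi_n)_{n\ge 0}$ be i.i.d. $\mathcal Z$-valued random variables with common law $\ell$, whose support $\mathcal E$ is compact. For $x\in\mathcal X$ and $\boldsymbol\zeta=(\zeta_n)_{n\ge0}\in\mathcal Z^{\mathbb N}$ put $S_0(x;\boldsymbol\zeta)=x$ and $S_{n+1}(x;\boldsymbol\zeta)=S(S_n(x;\boldsymbol\zeta),\zeta_n)$. Let $x_n=S_n(x;\boldsymbol\xi)$ be the process started at the deterministic point $x_0=x$, and let $P_n(x,\cdot)$ be the law of $x_n$. A Borel probability measure $\mu$ on $\mathcal X$ is *invariant* if $\int P_n(x,A)\,\mu(dx)=\mu(A)$ for all $n\in\mathbb N$ and all Borel sets $A$. For $\mathcal Y\subset\mathcal X$ let $$\mathcal Y_\infty=\overline{\bigcup_{n\ge0}\{S_n(x;\boldsymbol\zeta):x\in\mathcal Y,\ \zeta_0,\dots,\zeta_{n-1}\in\mathcal E\}}.$$ Assume that there is a set $\mathcal Y\subset\mathcal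 X$ satisfying the following three conditions. * (AC) $\mathcal Y$ is compact, and there are $\kappa>0$ and a measurable function $V:\mathcal X\to[0,\infty)$, bounded on bounded sets, such that $\operatorname{dist}(S_n(x;\boldsymbol\zeta),\mathcal Y)\le V(x)e^{-\kappa n}$ for all $x\in\mathcal X$, $\boldsymbol\zeta\in\mathcal E^{\mathbb N}$ and $n\ge1$. * (I) There is $z\in\mathcal Y$ such that for every $\varepsilon>0$ there is an integer $m\ge1$ with $\inf_{x\in\mathcal Y_\infty}P_m(x,B(z,\varepsilon))>0$, where $B(z,\varepsilon)$ is the open ball. * (C) There are $r\in[0,1)$, a continuous nondecreasing function $g:[0,\infty)\to[0,\infty)$ with $g(0)=0$ and $\limsup_{n\to\infty}\frac1n\ln g(r^n)<0$ (with $\ln 0=-\infty$), a probability space $(\Omega',\mathcal F',\mathbb P')$, and measurable maps $\mathcal R,\mathcal R':\mathcal Y_\infty\times\mathcal Y_\infty\times\Omega'\to\mathcal X$ such that for all $x,x'\in\mathcal Y_\infty$ the random variables $\mathcal R(x,x')$ and $\mathcal R'(x,x')$ have laws $P_1(x,\cdot)$ and $P_1(x',\cdot)$, and $$\mathbb P'\big(d(\mathcal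 R(x,x'),\mathcal R'(x,x'))>r\,d(x,x')\big)\le g(d(x,x')).$$ Then there is exactly one invariant Borel probability measure $\mu_*$ on $\mathcal X$, it has compact support, and, writing $\langle f,\mu_*\rangle=\int f\,d\mu_*$, every bounded Lipschitz function $f:\mathcal X\to\mathbb R$ satisfies: 1. (Strong law of large numbers) for every $x\in\mathcal X$, almost surely $\displaystyle\lim_{n\to\infty}\frac1n\sum_{k=0}^{n-1}f(x_k)=\langle f,\mu_*\rangle$; 2. (Central limit theorem) there is a constant $\sigma_f\ge0$, not depending on $x$, such that for every $x\in\mathcal X$ $$\frac1{\sqrt n}\sum_{k=0}^{n-1}\big(f(x_k)-\langle f,\mu_*\rangle\big)\longrightarrow\mathcal N(0,\sigma_f^2)\quad\text{in distribution as }n\to\infty,$$ where $\mathcal N(0,0)$ is the point mass at $0$. -/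

import Mathlib

open MeasureTheory ProbabilityTheory Filter Topology
open scoped NNReal ENNReal

universe u v w t

namespace RDS

section

variable {X Z : Type*}

/-- The process `x₀ = x`, `xₙ₊₁ = S (xₙ, ζₙ)`, i.e. `orbit S x ζ n = Sₙ(x; ζ₀, …, ζₙ₋₁)`. -/
def orbit (S : X × Z → X) (x : X) (ζ : ℕ → Z) : ℕ → X
  | 0 => x
  | n + 1 => S (orbit S x ζ n, ζ n)

/-- The attainable set from `Y` in time `n`, with inputs in the set `E`. -/
def attainable (S : X × Z → X) (E : Set Z) (Y : Set X) (n : ℕ) : Set X :=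
  {y | ∃ x ∈ Y, ∃ ζ : ℕ → Z, (∀ i < n, ζ i ∈ E) ∧ y = orbit S x ζ n}

/-- The attainable set `Y_∞`: the closure of the union of the attainable sets in time `n`. -/
def attainableInf [TopologicalSpace X] (S : X × Z → X) (E : Set Z) (Y : Set X) : Set X :=
  closure (⋃ n : ℕ, attainable S E Y n)

/-- The Markov transition function `P_n(x, ·)`: the law of `xₙ` for the process started at `x`
and driven by an i.i.d. sequence of inputs with common law `ℓ`. -/
noncomputable def transition [MeasurableSpace X] [MeasurableSpace Z] (S : X × Z → X)
    (ℓ : Measure Z) [IsProbabilityMeasure ℓ] (n : ℕ) (x : X) : Measure X :=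
  (Measure.infinitePi fun _ : ℕ => ℓ).map fun ζ => orbit S x ζ n

/-- `P_n^* μ = μ` for every `n`, where `P_n^* μ (A) = ∫ P_n(x, A) μ(dx)`. -/
def IsInvariant [MeasurableSpace X] [MeasurableSpace Z] (S : X × Z → X)
    (ℓ : Measure Z) [IsProbabilityMeasure ℓ] (μ : Measure X) : Prop :=
  ∀ n : ℕ, ∀ A : Set X, MeasurableSet A → ∫⁻ x, transition S ℓ n x A ∂μ = μ A

/-- Asymptotic compactness: all trajectories with inputs in `E` converge exponentially fast to
the compact set `Y`, with a prefactor `V` that is bounded on bounded sets. -/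
def AsymptoticCompactness [MetricSpace X] [MeasurableSpace X] (S : X × Z → X) (E : Set Z)
    (Y : Set X) : Prop :=
  IsCompact Y ∧
  ∃ κ : ℝ, 0 < κ ∧ ∃ V : X → ℝ≥0, Measurable V ∧
    (∀ B : Set X, Bornology.IsBounded B → ∃ C : ℝ≥0, ∀ x ∈ B, V x ≤ C) ∧
    ∀ (x : X) (ζ : ℕ → Z), (∀ i, ζ i ∈ E) → ∀ n : ℕ, 1 ≤ n →
      Metric.infDist (orbit S x ζ n) Y ≤ V x * Real.exp (-κ * n)

/-- Irreducibility on `Y_∞`. -/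
def Irreducibility [MetricSpace X] [MeasurableSpace X] [TopologicalSpace Z] [MeasurableSpace Z]
    (S : X × Z → X) (ℓ : Measure Z) [IsProbabilityMeasure ℓ] (Y : Set X) : Prop :=
  ∃ z ∈ Y, ∀ ε : ℝ, 0 < ε → ∃ m : ℕ, 1 ≤ m ∧
    0 < ⨅ x ∈ attainableInf S ℓ.support Y, transition S ℓ m x (Metric.ball z ε)

/-- The coupling condition on `Y_∞`. The logarithm is the extended one, with `log 0 = -∞`. -/
def CouplingCondition {X : Type u} {Z : Type v} [MetricSpace X] [MeasurableSpace X]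
    [TopologicalSpace Z] [MeasurableSpace Z]
    (S : X × Z → X) (ℓ : Measure Z) [IsProbabilityMeasure ℓ] (Y : Set X) : Prop :=
  ∃ r : ℝ≥0, r < 1 ∧
  ∃ g : ℝ≥0 → ℝ≥0, Continuous g ∧ Monotone g ∧ g 0 = 0 ∧
    limsup (fun n : ℕ => ENNReal.log (g (r ^ n) : ℝ≥0∞) / (n : EReal)) atTop < 0 ∧
  ∃ (Ω : Type w) (_ : MeasurableSpace Ω) (P : Measure Ω) (_ : IsProbabilityMeasure P)
    (R R' : attainableInf S ℓ.support Y × attainableInf S ℓ.support Y × Ω → X),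
    Measurable R ∧ Measurable R' ∧
    ∀ x x' : attainableInf S ℓ.support Y,
      P.map (fun ω => R (x, x', ω)) = transition S ℓ 1 x ∧
      P.map (fun ω => R' (x, x', ω)) = transition S ℓ 1 x' ∧
      P {ω | r * nndist x x' < nndist (R (x, x', ω)) (R' (x, x', ω))} ≤ g (nndist x x')

end

end RDS

/-! Write `T` for the Markov operator, `T f (x) = ∫ f (S (x, z)) ℓ(dz)`. Everything follows from
exponential decay of the oscillation of `T^n f` for bounded Lipschitz `f`, on compact sets that are
forward invariant under inputs from the support of `ℓ`.

Mixing on `Y_∞`. From `r` and `g` one builds a bounded gauge `D` of the distance with `D (r s) + g s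
≤ q D s`, `q < 1`, wherever `D s < 1` (`exists_gauge`). Consider functions with `|f x - f x'| ≤ a
D(d(x, x'))`. At pairs with `D < 1` the coupling (C) shrinks the constant `a`. At pairs with `D = 1`
two independent copies do it, since by (I) both land in one small ball with positive probability.
Hence some power of `T` contracts `a` (`exists_exp_decay_osc`). The gauge need not be a metric.

Mixing from any starting point. The attainable set `K` of `Y ∪ {x₀}` is compact by (AC), and `S` is
Lipschitz on `K × supp ℓ`. An orbit in `K` first approaches `Y` exponentially, then is compared,
under the same inputs, with an orbit from `Y` for a time so short in proportion that the Lipschitz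
growth is absorbed (`exists_exp_decay_osc_of_attracted`).

Limit theorems. Centred observables have `∑ ‖T^n f‖ < ∞`, so `f = φ - T φ` with `φ` continuous on
`K`. The function `exp (a φ)` is almost a supersolution for the operator weighted by `exp (a f)`;
this bounds exponential moments, and Borel–Cantelli gives the strong law (`ae_tendsto_average`). For
the central limit theorem the characteristic function at frequency `u = t/√n` is `(w T)^n 1` with `w
= exp (i u f)`; the explicit function `1 + i u φ - u² b` is an approximate eigenfunction with
eigenvalue `exp (-u² c)` and error small compared with `1/n` (`tendsto_iterate_phase_mul_op`).

Invariant measure. The laws of `x_n` started in `Y` are carried by the compact set `Y_∞`, so they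
have a limit point. Convergence of `T^n f` to a constant, the same for every starting point, makes
it invariant and unique. -/

namespace RDS

/-! ### The gauge attached to the coupling condition -/

/-- Extended logarithmic decay of a sequence gives a genuine exponential bound. -/
lemma exists_exp_bound_of_limsup_log_neg {a : ℕ → ℝ≥0}
    (h : limsup (fun n : ℕ => ENNReal.log (a n : ℝ≥0∞) / (n : EReal)) atTop < 0) :
    ∃ q : ℝ≥0, 0 < q ∧ q < 1 ∧ ∀ᶠ n in atTop, a n ≤ q ^ n := by
  obtain ⟨b, hb1, hb2⟩ := EReal.exists_between_coe_real h
  have hb : b < 0 := by exact_mod_cast hb2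
  refine ⟨(Real.exp b).toNNReal, by simpa using Real.exp_pos b, by simpa using hb, ?_⟩
  · filter_upwards [eventually_lt_of_limsup_lt hb1, eventually_ge_atTop 1] with n hn hn1
    have hn0 : (0 : EReal) < n := by exact_mod_cast hn1
    have h1 : ENNReal.log (a n : ℝ≥0∞) < ((n * b : ℝ) : EReal) := by
      have := (EReal.div_lt_iff hn0 (EReal.natCast_ne_top n)).1 hn
      simpa [mul_comm] using this
    have h2 := EReal.exp_monotone h1.le
    rw [ENNReal.exp_log, EReal.exp_coe, Real.exp_nat_mul] at h2
    rw [← ENNReal.coe_le_coe]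
    refine h2.trans (le_of_eq ?_)
    rw [ENNReal.ofReal, Real.toNNReal_pow (Real.exp_pos b).le]

/-- The series `H s = ∑ θ^(n+1) (g (r^n s) + r^n s)` solves `H s = θ (g s + s) + θ H (r s)`, so `H
(r s) + g s ≤ θ⁻¹ H s`; the gauge is `min 1 H`. The decay of `g (r^n)` leaves room for some `θ > 1`,
and the summand `r^n s` makes `H` dominate the distance itself. -/
lemma exists_gauge {r : ℝ≥0} (hr : r < 1) {g : ℝ≥0 → ℝ≥0} (hgc : Continuous g)
    (hgm : Monotone g) (hg0 : g 0 = 0)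
    (hlim : limsup (fun n : ℕ => ENNReal.log (g (r ^ n) : ℝ≥0∞) / (n : EReal)) atTop < 0) :
    ∃ D : ℝ≥0 → ℝ, Monotone D ∧ (∀ s, 0 ≤ D s) ∧ (∀ s, D s ≤ 1) ∧
      (∀ s : ℝ≥0, min (s : ℝ) 1 ≤ D s) ∧ (∃ s₀, 0 < s₀ ∧ D s₀ ≤ 1 / 2) ∧
      ∃ q : ℝ, 0 ≤ q ∧ q < 1 ∧ ∀ s, D s < 1 → D (r * s) + g s ≤ q * D s := by
  obtain ⟨q₀, hq₀, hq₀', hbound⟩ := exists_exp_bound_of_limsup_log_neg hlim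
  obtain ⟨q, hqpos, hq1, hq0, hqr⟩ : ∃ q : ℝ≥0, 0 < q ∧ q < 1 ∧ q₀ ≤ q ∧ r ≤ q :=
    ⟨max q₀ r, lt_max_of_lt_left hq₀, max_lt hq₀' hr, le_max_left _ _, le_max_right _ _⟩
  -- `θ > 1` yields the contraction factor `θ⁻¹`, while `θ q < 1` keeps the series summable at `s =
  -- 1`.
  obtain ⟨θ, hθ1, hθq⟩ : ∃ θ : ℝ≥0, 1 < θ ∧ θ * q < 1 := by
    obtain ⟨θ, h1, h2⟩ := exists_between ((one_lt_inv₀ hqpos).2 hq1)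
    exact ⟨θ, h1, by rwa [← lt_inv_mul_iff₀' hqpos, mul_one] ⟩
  have hθ0 : θ ≠ 0 := (zero_lt_one.trans hθ1).ne'
  set u : ℕ → ℝ≥0 → ℝ≥0 := fun n s => θ ^ (n + 1) * (g (r ^ n * s) + r ^ n * s) with hu
  have hum : ∀ n, Monotone (u n) := fun n s s' h => by
    have := hgm (mul_le_mul_right h (r ^ n))
    simp only [hu]; gcongr
  set H : ℝ≥0 → ℝ≥0∞ := fun s => ∑' n, (u n s : ℝ≥0∞) with hH
  have hHm : Monotone H := fun s s' h =>
    ENNReal.tsum_le_tsum fun n => ENNReal.coe_le_coe.2 (hum n h)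
  have hHrec : ∀ s, H s = θ * ((g s + s : ℝ≥0) : ℝ≥0∞) + θ * H (r * s) := fun s => by
    simp only [hH]
    rw [tsum_eq_zero_add' ENNReal.summable, ← ENNReal.tsum_mul_left]
    congr 1
    · simp [hu]
    · refine tsum_congr fun n => ?_
      simp only [hu]; rw [← ENNReal.coe_mul]; congr 1
      rw [show r ^ (n + 1) * s = r ^ n * (r * s) by ring]; ring
  have hH1 : H 1 ≠ ∞ := by
    have hsum : Summable fun n => u n 1 := by
      have hg : Summable fun n : ℕ => 2 * θ * (θ * q) ^ n :=
        (NNReal.summable_geometric hθq).mul_left _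
      refine (summable_of_isBigO_nat' (E := ℝ) (f := fun n => (u n 1 : ℝ))
        (g := fun n : ℕ => ((2 * θ * (θ * q) ^ n : ℝ≥0) : ℝ)) ?_ ?_) |> NNReal.summable_coe.1
      · exact NNReal.summable_coe.2 hg
      · refine Asymptotics.IsBigO.of_bound 1 ?_
        filter_upwards [hbound] with n hn
        have : u n 1 ≤ 2 * θ * (θ * q) ^ n := by
          have h1 : g (r ^ n * 1) ≤ q ^ n := by
            rw [mul_one]; exact hn.trans (pow_le_pow_left' hq0 n)
          have h2 : r ^ n * 1 ≤ q ^ n := by rw [mul_one]; exact pow_le_pow_left' hqr n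
          calc u n 1 ≤ θ ^ (n + 1) * (q ^ n + q ^ n) := by simp only [hu]; gcongr
            _ = _ := by ring
        rw [Real.norm_of_nonneg (NNReal.coe_nonneg _), Real.norm_of_nonneg (NNReal.coe_nonneg _),
          one_mul]
        exact_mod_cast this
    exact ENNReal.tsum_coe_ne_top_iff_summable.2 hsum
  -- The tail is controlled uniformly on `[0, 1]` by its value at `1`, and the remaining finite sum
  -- is continuous and vanishes at `0`.
  have hsmall : ∃ s₀, 0 < s₀ ∧ H s₀ ≤ 1 / 2 := by
    have hq4 : (0 : ℝ≥0∞) < 1 / 4 := by norm_num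
    obtain ⟨N, hN⟩ := ((ENNReal.tendsto_sum_nat_add (fun n => (u n 1 : ℝ≥0∞)) hH1).eventually
      (eventually_lt_nhds hq4)).exists
    have hcont : Continuous fun s : ℝ≥0 => ∑ n ∈ Finset.range N, (u n s : ℝ≥0∞) := by
      refine continuous_finsetSum _ fun n _ => ENNReal.continuous_coe.comp ?_
      simp only [hu]; fun_prop
    have h0 : ∑ n ∈ Finset.range N, (u n 0 : ℝ≥0∞) = 0 := by simp [hu, hg0]
    have hev := (hcont.tendsto 0).eventually (eventually_lt_nhds (by rw [h0]; exact hq4))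
    obtain ⟨s, hs, hs0⟩ : ∃ s, (∑ n ∈ Finset.range N, (u n s : ℝ≥0∞) < 1 / 4 ∧ s ≤ 1) ∧ 0 < s := by
      have h1 : ∀ᶠ s : ℝ≥0 in 𝓝[>] 0, s ≤ 1 :=
        mem_nhdsWithin_of_mem_nhds (Iic_mem_nhds zero_lt_one)
      exact ((((hev.filter_mono nhdsWithin_le_nhds).and h1)).and self_mem_nhdsWithin).exists
    refine ⟨s, hs0, ?_⟩
    have hsplit : H s = ∑ n ∈ Finset.range N, (u n s : ℝ≥0∞) + ∑' n, (u (n + N) s : ℝ≥0∞) :=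
      (ENNReal.summable.sum_add_tsum_nat_add' (f := fun n => (u n s : ℝ≥0∞)) (k := N)).symm
    rw [hsplit]
    have : ∑' n, (u (n + N) s : ℝ≥0∞) ≤ 1 / 4 :=
      (ENNReal.tsum_le_tsum fun n => ENNReal.coe_le_coe.2 (hum _ hs.2)).trans hN.le
    refine (add_le_add hs.1.le this).trans (le_of_eq ?_)
    rw [ENNReal.div_add_div_same, ENNReal.div_eq_div_iff (by simp) (by simp) (by simp) (by simp)]
    norm_num
  have hle : ∀ s : ℝ≥0, (s : ℝ≥0∞) ≤ H s := fun s => by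
    rw [hHrec s]
    refine le_trans ?_ le_self_add
    rw [← ENNReal.coe_mul, ENNReal.coe_le_coe]
    calc s ≤ 1 * (g s + s) := by simp
      _ ≤ _ := by gcongr
  have hfin : ∀ x : ℝ≥0∞, min 1 x ≠ ∞ := fun x => (min_lt_of_left_lt ENNReal.one_lt_top).ne
  refine ⟨fun s => (min 1 (H s)).toReal, fun s s' h => ?_, fun s => ENNReal.toReal_nonneg,
    fun s => ?_, fun s => ?_, ?_, (θ⁻¹ : ℝ≥0), NNReal.coe_nonneg _, ?_, fun s hs => ?_⟩
  · exact ENNReal.toReal_mono (hfin _) (min_le_min le_rfl (hHm h))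
  · simpa using ENNReal.toReal_mono ENNReal.one_ne_top (min_le_left 1 (H s))
  · have h := ENNReal.toReal_mono (hfin _) (min_le_min (le_refl (1 : ℝ≥0∞)) (hle s))
    rw [min_comm]
    refine le_trans (le_of_eq ?_) h
    rw [ENNReal.toReal_min ENNReal.one_ne_top ENNReal.coe_ne_top]; simp
  · obtain ⟨s₀, hs₀, h⟩ := hsmall
    refine ⟨s₀, hs₀, ?_⟩
    have := ENNReal.toReal_mono (by norm_num) ((min_le_right 1 (H s₀)).trans h)
    simpa using this
  · rw [NNReal.coe_lt_one]; exact inv_lt_one_of_one_lt₀ hθ1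
  · beta_reduce at hs ⊢
    -- Below the truncation level the gauge equals `H`, which is then finite, so the recursion for
    -- `H` passes to real numbers.
    have hs1 : H s < 1 := by
      by_contra! hcon
      rw [min_eq_left hcon] at hs
      simp at hs
    have hsn : H s ≠ ∞ := (hs1.trans ENNReal.one_lt_top).ne
    have hkey : H (r * s) + g s ≤ (θ⁻¹ : ℝ≥0) * H s := by
      rw [hHrec s, mul_add, ← mul_assoc, ← mul_assoc, ← ENNReal.coe_mul, inv_mul_cancel₀ hθ0,
        ENNReal.coe_one, one_mul, one_mul, add_comm]
      gcongr
      simp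
    have hn2 : (θ⁻¹ : ℝ≥0) * H s ≠ ∞ := ENNReal.mul_ne_top ENNReal.coe_ne_top hsn
    have hn3 : H (r * s) ≠ ∞ := ne_top_of_le_ne_top hn2 (le_self_add.trans hkey)
    have h4 := ENNReal.toReal_mono hn2 hkey
    rw [ENNReal.toReal_add hn3 ENNReal.coe_ne_top, ENNReal.toReal_mul] at h4
    rw [min_eq_right hs1.le]
    refine le_trans ?_ h4
    exact add_le_add (ENNReal.toReal_mono hn3 (min_le_right _ _)) (by simp)


/-! ### The Markov operator and multiplicative functionals of orbits -/

section Markov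

variable {X : Type*} {Z : Type*}

lemma orbit_succ_eq_orbit_shift (S : X × Z → X) (x : X) (ζ : ℕ → Z) (n : ℕ) :
    orbit S x ζ (n + 1) = orbit S (S (x, ζ 0)) (fun i => ζ (i + 1)) n := by
  induction n with
  | zero => rfl
  | succ n ih => rw [orbit, ih, orbit]

variable [MeasurableSpace X] [MeasurableSpace Z]

lemma measurable_orbit {S : X × Z → X} (hS : Measurable S) (n : ℕ) :
    Measurable fun p : X × (ℕ → Z) => orbit S p.1 p.2 n := by
  induction n with
  | zero => exact measurable_fst
  | succ n ih =>
    exact hS.comp (ih.prodMk ((measurable_pi_apply n).comp measurable_snd))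

lemma measurable_orbit_right {S : X × Z → X} (hS : Measurable S) (x : X) (n : ℕ) :
    Measurable fun ζ : ℕ → Z => orbit S x ζ n :=
  (measurable_orbit hS n).comp measurable_prodMk_left

/-- This carries the Markov property: the first input is independent of the shifted sequence, which
has the same law. It is checked for the inverse map `c` on cylinders, where the product over `s`
splits off the index `0`. -/
lemma measurePreserving_head_tail (ℓ : Measure Z) [IsProbabilityMeasure ℓ] :
    MeasurePreserving (fun ζ : ℕ → Z => (ζ 0, fun i => ζ (i + 1)))
      (Measure.infinitePi fun _ : ℕ => ℓ) (ℓ.prod (Measure.infinitePi fun _ : ℕ => ℓ)) := by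
  set c : Z × (ℕ → Z) → ℕ → Z := fun p i => Nat.casesOn i p.1 p.2 with hc
  have hcm : Measurable c := measurable_pi_lambda _ fun i => by
    cases i with
    | zero => exact measurable_fst
    | succ i => exact (measurable_pi_apply i).comp measurable_snd
  have hdm : Measurable fun ζ : ℕ → Z => (ζ 0, fun i => ζ (i + 1)) := by fun_prop
  have key : (ℓ.prod (Measure.infinitePi fun _ : ℕ => ℓ)).map c =
      Measure.infinitePi fun _ : ℕ => ℓ := by
    refine Measure.eq_infinitePi _ fun s t ht => ?_
    have hpre : c ⁻¹' ((s : Set ℕ).pi t) =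
        {z | 0 ∈ s → z ∈ t 0} ×ˢ
          (((s.erase 0).image Nat.pred : Finset ℕ) : Set ℕ).pi (fun i => t (i + 1)) := by
      ext ⟨z, ζ⟩
      simp only [Set.mem_preimage, Set.mem_pi, Finset.mem_coe, Set.mem_prod, Set.mem_ofPred_eq,
        Finset.mem_image, Finset.mem_erase]
      constructor
      · intro h
        refine ⟨fun h0 => h 0 h0, ?_⟩
        rintro i ⟨j, ⟨hj0, hj⟩, rfl⟩
        obtain ⟨k, rfl⟩ := Nat.exists_eq_succ_of_ne_zero hj0
        exact h _ hj
      · rintro ⟨h0, h⟩ i hi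
        cases i with
        | zero => exact h0 hi
        | succ i => exact h i ⟨i + 1, ⟨by simp, hi⟩, rfl⟩
    rw [Measure.map_apply hcm (.pi s.countable_toSet fun i _ => ht i), hpre, Measure.prod_prod,
      Measure.infinitePi_pi _ fun i _ => ht _]
    rw [Finset.prod_image (g := Nat.pred)]
    · have h2 : ∏ x ∈ s.erase 0, ℓ (t (x.pred + 1)) = ∏ x ∈ s.erase 0, ℓ (t x) :=
        Finset.prod_congr rfl fun i hi => by
          rw [← Nat.succ_eq_add_one, Nat.succ_pred (Finset.ne_of_mem_erase hi)]
      rw [h2]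
      by_cases h0 : 0 ∈ s
      · rw [← Finset.mul_prod_erase s _ h0]; simp [h0]
      · rw [Finset.erase_eq_of_notMem h0]; simp [h0]
    · intro i hi j hj hij
      simp only [Finset.coe_erase, Set.mem_sdiff, Finset.mem_coe, Set.mem_singleton_iff] at hi hj
      exact Nat.pred_inj (Nat.pos_of_ne_zero hi.2) (Nat.pos_of_ne_zero hj.2) hij
  refine ⟨hdm, ?_⟩
  conv_lhs => rw [← key]
  rw [Measure.map_map hdm hcm]
  exact Measure.map_id

variable {𝕜 : Type*} [RCLike 𝕜]

/-- Bounded measurable functions. -/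
structure BddMeasurable (h : X → 𝕜) : Prop where
  measurable : Measurable h
  bdd : ∃ C, ∀ x, ‖h x‖ ≤ C

/-- The Markov operator `h ↦ ∫ h (S (·, z)) ℓ(dz)`. -/
noncomputable def markovOp (S : X × Z → X) (ℓ : Measure Z) (h : X → 𝕜) (x : X) : 𝕜 :=
  ∫ z, h (S (x, z)) ∂ℓ

lemma BddMeasurable.integrable {Ω : Type*} [MeasurableSpace Ω] {μ : Measure Ω} [IsFiniteMeasure μ]
    {h : X → 𝕜} (hh : BddMeasurable h) {f : Ω → X} (hf : Measurable f) :
    Integrable (fun ω => h (f ω)) μ := by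
  obtain ⟨C, hC⟩ := hh.bdd
  exact .of_bound (hh.measurable.comp hf).aestronglyMeasurable C (.of_forall fun _ => hC _)

lemma BddMeasurable.mul {h h' : X → 𝕜} (hh : BddMeasurable h) (hh' : BddMeasurable h') :
    BddMeasurable fun x => h x * h' x := by
  obtain ⟨C, hC⟩ := hh.bdd
  obtain ⟨C', hC'⟩ := hh'.bdd
  refine ⟨hh.measurable.mul hh'.measurable, C * C', fun x => ?_⟩
  rw [norm_mul]
  exact mul_le_mul (hC x) (hC' x) (norm_nonneg _) ((norm_nonneg _).trans (hC x))

lemma BddMeasurable.integral {Ω : Type*} [MeasurableSpace Ω] {μ : Measure Ω}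
    [IsProbabilityMeasure μ] {h : X → 𝕜} (hh : BddMeasurable h) {F : X × Ω → X}
    (hF : Measurable F) : BddMeasurable fun x => ∫ ω, h (F (x, ω)) ∂μ := by
  obtain ⟨C, hC⟩ := hh.bdd
  refine ⟨?_, C, fun x => ?_⟩
  · exact (StronglyMeasurable.integral_prod_right'
      (f := fun p => h (F p)) (hh.measurable.comp hF).stronglyMeasurable).measurable
  · simpa using norm_integral_le_of_norm_le_const (μ := μ) (.of_forall fun ω => hC (F (x, ω)))

/-- Feynman–Kac formula: multiplicative functionals of the orbit are computed by iterating the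
weighted Markov operator. -/
lemma integral_prod_mul_orbit {S : X × Z → X} (hS : Measurable S) (ℓ : Measure Z)
    [IsProbabilityMeasure ℓ] {w h : X → 𝕜} (hw : BddMeasurable w) (hh : BddMeasurable h)
    (n : ℕ) (x : X) :
    ∫ ζ, (∏ k ∈ Finset.range n, w (orbit S x ζ k)) * h (orbit S x ζ n)
        ∂(Measure.infinitePi fun _ : ℕ => ℓ) =
      (fun (f : X → 𝕜) x => w x * markovOp S ℓ f x)^[n] h x := by
  induction n generalizing x with
  | zero => simp [orbit]
  | succ n ih =>
    set F : X × (ℕ → Z) → 𝕜 := fun p =>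
      (∏ k ∈ Finset.range n, w (orbit S p.1 p.2 k)) * h (orbit S p.1 p.2 n) with hF
    have hFb : BddMeasurable F := by
      obtain ⟨C, hC⟩ := hw.bdd
      obtain ⟨C', hC'⟩ := hh.bdd
      refine BddMeasurable.mul ⟨?_, C ^ n, fun p => ?_⟩
        ⟨hh.measurable.comp (measurable_orbit hS n), C', fun p => hC' _⟩
      · exact Finset.measurable_prod _ fun k _ => hw.measurable.comp (measurable_orbit hS k)
      · rw [norm_prod]
        simpa using Finset.prod_le_prod (s := Finset.range n) (fun _ _ => norm_nonneg _)
          fun k _ => hC (orbit S p.1 p.2 k)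
    have hSx : Measurable fun q : Z × (ℕ → Z) => (S (x, q.1), q.2) :=
      (hS.comp (measurable_const.prodMk measurable_fst)).prodMk measurable_snd
    rw [Function.iterate_succ_apply', markovOp]
    simp_rw [← ih]
    rw [← integral_prod (f := fun q : Z × (ℕ → Z) => F (S (x, q.1), q.2))
      (hFb.integrable hSx), ← (measurePreserving_head_tail ℓ).map_eq,
      integral_map (f := fun q : Z × (ℕ → Z) => F (S (x, q.1), q.2))
        (measurePreserving_head_tail ℓ).measurable.aemeasurable
        (hFb.measurable.comp hSx).aestronglyMeasurable, ← integral_const_mul]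
    refine integral_congr_ae (.of_forall fun ζ => ?_)
    simp only [hF, Finset.prod_range_succ', orbit_succ_eq_orbit_shift]
    rw [orbit]; ring

lemma integral_orbit {S : X × Z → X} (hS : Measurable S) (ℓ : Measure Z)
    [IsProbabilityMeasure ℓ] {h : X → 𝕜} (hh : BddMeasurable h) (n : ℕ) (x : X) :
    ∫ ζ, h (orbit S x ζ n) ∂(Measure.infinitePi fun _ : ℕ => ℓ) = (markovOp S ℓ)^[n] h x := by
  have := integral_prod_mul_orbit hS ℓ (w := fun _ => (1 : 𝕜)) ⟨measurable_const, 1, by simp⟩ hh n x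
  simpa using this

lemma BddMeasurable.markovOp_iterate {S : X × Z → X} (hS : Measurable S) (ℓ : Measure Z)
    [IsProbabilityMeasure ℓ] {h : X → 𝕜} (hh : BddMeasurable h) (n : ℕ) :
    BddMeasurable ((markovOp S ℓ)^[n] h) := by
  induction n with
  | zero => exact hh
  | succ n ih => rw [Function.iterate_succ_apply']; exact ih.integral hS

lemma integral_transition {S : X × Z → X} (hS : Measurable S) (ℓ : Measure Z)
    [IsProbabilityMeasure ℓ] {h : X → 𝕜} (hh : BddMeasurable h) (n : ℕ) (x : X) :
    ∫ y, h y ∂(transition S ℓ n x) = (markovOp S ℓ)^[n] h x := by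
  rw [← integral_orbit hS ℓ hh, transition, integral_map
    (measurable_orbit_right hS x n).aemeasurable hh.measurable.aestronglyMeasurable]

lemma isProbabilityMeasure_transition {S : X × Z → X} (hS : Measurable S)
    (ℓ : Measure Z) [IsProbabilityMeasure ℓ] (n : ℕ) (x : X) :
    IsProbabilityMeasure (transition S ℓ n x) :=
  Measure.isProbabilityMeasure_map (measurable_orbit_right hS x n).aemeasurable

end Markov


/-- Turns a contraction once every `m` steps into a rate per step, `q = α^(1/m)`; the constant `α⁻¹`
pays for the incomplete last block. -/
lemma exists_pow_div_le {α : ℝ} (h0 : 0 < α) (h1 : α < 1) {m : ℕ} (hm : 1 ≤ m) :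
    ∃ C q : ℝ, 0 ≤ C ∧ 0 < q ∧ q < 1 ∧ ∀ n : ℕ, α ^ (n / m) ≤ C * q ^ n := by
  have hm0 : (m : ℝ) ≠ 0 := by positivity
  have hqm : (α ^ ((m : ℝ)⁻¹)) ^ m = α := Real.rpow_inv_natCast_pow h0.le (by omega)
  set q := α ^ ((m : ℝ)⁻¹) with hq
  have hq0 : 0 < q := Real.rpow_pos_of_pos h0 _
  have hq1 : q < 1 := Real.rpow_lt_one h0.le h1 (by positivity)
  refine ⟨α⁻¹, q, by positivity, hq0, hq1, fun n => ?_⟩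
  rw [le_inv_mul_iff₀ h0]
  calc α * α ^ (n / m) = q ^ m * (q ^ m) ^ (n / m) := by rw [hqm]
    _ ≤ q ^ (n % m) * (q ^ m) ^ (n / m) := by
        gcongr ?_ * _
        exact pow_le_pow_of_le_one hq0.le hq1.le (Nat.mod_lt _ hm).le
    _ = q ^ n := by rw [← pow_mul, ← pow_add, Nat.mod_add_div]

/-! ### Contraction of gauge-Lipschitz functions on `Y_∞` -/

section Contraction

variable {X : Type*} {Z : Type*}

/-- The estimate comes from the independent coupling of the two laws. -/
lemma abs_integral_sub_integral_le [MeasurableSpace X] {ρ ρ' : Measure X}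
    [IsProbabilityMeasure ρ] [IsProbabilityMeasure ρ'] {f : X → ℝ} (hf : BddMeasurable f)
    {G : X × X → ℝ} (hG : Integrable G (ρ.prod ρ'))
    (h : ∀ᵐ p ∂(ρ.prod ρ'), |f p.1 - f p.2| ≤ G p) :
    |∫ y, f y ∂ρ - ∫ y, f y ∂ρ'| ≤ ∫ p, G p ∂(ρ.prod ρ') := by
  have h1 : ∫ p, (f p.1 - f p.2) ∂(ρ.prod ρ') = ∫ y, f y ∂ρ - ∫ y, f y ∂ρ' := by
    rw [integral_sub (hf.integrable measurable_fst) (hf.integrable measurable_snd),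
      integral_fun_fst, integral_fun_snd]
    simp
  rw [← h1, ← Real.norm_eq_abs]
  exact norm_integral_le_of_norm_le hG h

/-- `f` is Lipschitz on `K` with constant `a` for the distance-like function `D (d x x')`. -/
def GaugeLipschitzOn [MetricSpace X] (D : ℝ≥0 → ℝ) (K : Set X) (a : ℝ) (f : X → ℝ) : Prop :=
  ∀ x ∈ K, ∀ x' ∈ K, |f x - f x'| ≤ a * D (nndist x x')

lemma GaugeLipschitzOn.abs_sub_le [MetricSpace X] {K : Set X} {D : ℝ≥0 → ℝ} {f : X → ℝ} {a : ℝ}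
    (hD : ∀ s, D s ≤ 1) (ha : 0 ≤ a)
    (hf : GaugeLipschitzOn D K a f) {x x' : X} (hx : x ∈ K) (hx' : x' ∈ K) :
    |f x - f x'| ≤ a :=
  (hf x hx x' hx').trans (mul_le_of_le_one_right ha (hD _))

variable [MetricSpace X] [MeasurableSpace X] [MeasurableSpace Z] {S : X × Z → X} {ℓ : Measure Z}
  [IsProbabilityMeasure ℓ] {K : Set X} {D : ℝ≥0 → ℝ} {f : X → ℝ} {a : ℝ}

lemma GaugeLipschitzOn.abs_markovOp_iterate_sub_le (hS : Measurable S)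
    (hfwd : ∀ n, ∀ x ∈ K, ∀ᵐ y ∂(transition S ℓ n x), y ∈ K) (hD : ∀ s, D s ≤ 1) (ha : 0 ≤ a)
    (hfb : BddMeasurable f) (hf : GaugeLipschitzOn D K a f) (n : ℕ)
    {x x' : X} (hx : x ∈ K) (hx' : x' ∈ K) :
    |(markovOp S ℓ)^[n] f x - (markovOp S ℓ)^[n] f x'| ≤ a := by
  have := isProbabilityMeasure_transition hS ℓ n x
  have := isProbabilityMeasure_transition hS ℓ n x'
  rw [← integral_transition hS ℓ hfb, ← integral_transition hS ℓ hfb]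
  refine (abs_integral_sub_integral_le hfb (integrable_const a) ?_).trans (by simp)
  filter_upwards [Measure.quasiMeasurePreserving_fst.ae (hfwd n x hx),
    Measure.quasiMeasurePreserving_snd.ae (hfwd n x' hx')] with p hp hp'
  exact hf.abs_sub_le hD ha hp hp'

/-- Two independent copies are both in `B` with probability at least `p²`, and there the gauge is at
most `1/2` instead of `1`; the saving is `a/2` on that event. This handles far pairs. -/
lemma GaugeLipschitzOn.abs_markovOp_iterate_sub_le_of_hitting (hS : Measurable S)
    (hfwd : ∀ n, ∀ x ∈ K, ∀ᵐ y ∂(transition S ℓ n x), y ∈ K) (hD : ∀ s, D s ≤ 1) (ha : 0 ≤ a)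
    (hfb : BddMeasurable f) (hf : GaugeLipschitzOn D K a f) (n : ℕ)
    {B : Set X} (hB : MeasurableSet B) (hDB : ∀ y ∈ B, ∀ y' ∈ B, D (nndist y y') ≤ 1 / 2)
    {p : ℝ} (hp : 0 ≤ p) (hpB : ∀ x ∈ K, p ≤ (transition S ℓ n x).real B)
    {x x' : X} (hx : x ∈ K) (hx' : x' ∈ K) :
    |(markovOp S ℓ)^[n] f x - (markovOp S ℓ)^[n] f x'| ≤ (1 - p ^ 2 / 2) * a := by
  have := isProbabilityMeasure_transition hS ℓ n x
  have := isProbabilityMeasure_transition hS ℓ n x'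
  rw [← integral_transition hS ℓ hfb, ← integral_transition hS ℓ hfb]
  have hi : Integrable ((B ×ˢ B).indicator fun _ => a / 2)
      ((transition S ℓ n x).prod (transition S ℓ n x')) :=
    (integrable_const _).indicator (hB.prod hB)
  refine (abs_integral_sub_integral_le hfb
    (G := fun q => a - (B ×ˢ B).indicator (fun _ => a / 2) q)
    ((integrable_const a).sub hi) ?_).trans ?_
  · filter_upwards [Measure.quasiMeasurePreserving_fst.ae (hfwd n x hx),
      Measure.quasiMeasurePreserving_snd.ae (hfwd n x' hx')] with q hq hq'
    by_cases hqB : q ∈ B ×ˢ B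
    · rw [Set.indicator_of_mem hqB]
      have := mul_le_mul_of_nonneg_left (hDB q.1 hqB.1 q.2 hqB.2) ha
      linarith [hf q.1 hq q.2 hq']
    · rw [Set.indicator_of_notMem hqB, sub_zero]
      exact hf.abs_sub_le hD ha hq hq'
  · rw [integral_sub (integrable_const a) hi, integral_indicator_const _ (hB.prod hB),
      measureReal_prod_prod]
    have := mul_le_mul (hpB x hx) (hpB x' hx') hp measureReal_nonneg
    simp only [integral_const, probReal_univ, smul_eq_mul, one_mul]
    nlinarith

variable [BorelSpace X] [SecondCountableTopology X] {r : ℝ≥0} {g : ℝ≥0 → ℝ≥0}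

/-- Split along the coupling: where the distance shrinks by `r`, monotonicity of the gauge gives `a
D (r d)`; the exceptional event has probability at most `g d` and costs at most `a`. This handles
near pairs. -/
lemma GaugeLipschitzOn.abs_markovOp_sub_le_of_coupling (hS : Measurable S)
    (hfwd : ∀ n, ∀ x ∈ K, ∀ᵐ y ∂(transition S ℓ n x), y ∈ K) (hD0 : ∀ s, 0 ≤ D s)
    (hD : ∀ s, D s ≤ 1) (hDm : Monotone D) (ha : 0 ≤ a)
    (hfb : BddMeasurable f) (hf : GaugeLipschitzOn D K a f)
    {x x' : X} (hx : x ∈ K) (hx' : x' ∈ K)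
    {Ω : Type*} [MeasurableSpace Ω] {P : Measure Ω} [IsProbabilityMeasure P] {R R' : Ω → X}
    (hR : Measurable R) (hR' : Measurable R')
    (hRl : P.map R = transition S ℓ 1 x) (hRl' : P.map R' = transition S ℓ 1 x')
    (hP : P {ω | r * nndist x x' < nndist (R ω) (R' ω)} ≤ g (nndist x x')) :
    |markovOp S ℓ f x - markovOp S ℓ f x'| ≤
      a * (D (r * nndist x x') + g (nndist x x')) := by
  set d := nndist x x' with hd
  set A := {ω | r * d < nndist (R ω) (R' ω)} with hA
  have hAm : MeasurableSet A := measurableSet_lt measurable_const (hR.nndist hR')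
  have e1 : ∀ y (Q : Ω → X), Measurable Q → P.map Q = transition S ℓ 1 y →
      markovOp S ℓ f y = ∫ ω, f (Q ω) ∂P := fun y Q hQ h => by
    have := integral_transition hS ℓ hfb 1 y
    rw [Function.iterate_one] at this
    rw [← this, ← h, integral_map hQ.aemeasurable hfb.measurable.aestronglyMeasurable]
  rw [e1 x R hR hRl, e1 x' R' hR' hRl',
    ← integral_sub (hfb.integrable hR) (hfb.integrable hR'), ← Real.norm_eq_abs]
  have m1 : ∀ᵐ ω ∂P, R ω ∈ K := by
    refine ae_of_ae_map hR.aemeasurable ?_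
    rw [hRl]; exact hfwd 1 x hx
  have m2 : ∀ᵐ ω ∂P, R' ω ∈ K := by
    refine ae_of_ae_map hR'.aemeasurable ?_
    rw [hRl']; exact hfwd 1 x' hx'
  have hi : Integrable (A.indicator fun _ => a) P := (integrable_const _).indicator hAm
  refine (norm_integral_le_of_norm_le (g := fun ω => a * D (r * d) + A.indicator (fun _ => a) ω)
    ((integrable_const _).add hi) ?_).trans ?_
  · filter_upwards [m1, m2] with ω h1 h2
    by_cases hω : ω ∈ A
    · rw [Set.indicator_of_mem hω]
      exact (hf.abs_sub_le hD ha h1 h2).trans (le_add_of_nonneg_left (mul_nonneg ha (hD0 _)))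
    · rw [Set.indicator_of_notMem hω, add_zero]
      refine (hf _ h1 _ h2).trans (mul_le_mul_of_nonneg_left (hDm ?_) ha)
      simpa [hA] using hω
  · rw [integral_add (integrable_const _) hi, integral_indicator_const _ hAm]
    have : P.real A ≤ g d := by
      rw [measureReal_def]
      simpa using ENNReal.toReal_mono ENNReal.coe_ne_top hP
    have h3 := mul_le_mul_of_nonneg_right this ha
    simp only [integral_const, probReal_univ, smul_eq_mul, one_mul]
    linarith

/-- Exponential decay of oscillations on a compact set satisfying irreducibility and the
coupling condition. -/
theorem exists_exp_decay_osc [TopologicalSpace Z] {Y : Set X} (hS : Measurable S)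
    (hfwd : ∀ n, ∀ x ∈ attainableInf S ℓ.support Y, ∀ᵐ y ∂(transition S ℓ n x),
      y ∈ attainableInf S ℓ.support Y)
    (hI : Irreducibility S ℓ Y) (hC : CouplingCondition S ℓ Y) :
    ∃ C q : ℝ, 0 ≤ C ∧ 0 < q ∧ q < 1 ∧ ∀ (f : X → ℝ) (A : ℝ), Measurable f → (∀ x, |f x| ≤ A) →
      (∀ x ∈ attainableInf S ℓ.support Y, ∀ x' ∈ attainableInf S ℓ.support Y,
        |f x - f x'| ≤ A * dist x x') →
      ∀ n, ∀ x ∈ attainableInf S ℓ.support Y, ∀ x' ∈ attainableInf S ℓ.support Y,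
        |(markovOp S ℓ)^[n] f x - (markovOp S ℓ)^[n] f x'| ≤ A * (C * q ^ n) := by
  obtain ⟨r, hr, g, hgc, hgm, hg0, hlim, Ω, _, P, _, R, R', hR, hR', hcoup⟩ := hC
  obtain ⟨D, hDm, hD0, hD1, hDs, ⟨s₀, hs₀, hDs₀⟩, q, hq0, hq1, hDq⟩ :=
    exists_gauge hr hgc hgm hg0 hlim
  obtain ⟨z, -, hz⟩ := hI
  obtain ⟨m, hm1, hm⟩ := hz (s₀ / 2) (by positivity)
  set K := attainableInf S ℓ.support Y with hK
  set B := Metric.ball z (s₀ / 2 : ℝ) with hB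
  obtain ⟨p, hp0, hp⟩ := ENNReal.lt_iff_exists_nnreal_btwn.1 hm
  have hp0' : (0 : ℝ) < p := by exact_mod_cast hp0
  have hpB : ∀ x ∈ K, (p : ℝ) ≤ (transition S ℓ m x).real B := fun x hx => by
    have := isProbabilityMeasure_transition hS ℓ m x
    have h1 : (p : ℝ≥0∞) ≤ transition S ℓ m x B := hp.le.trans (iInf₂_le x hx)
    simpa [measureReal_def] using ENNReal.toReal_mono (measure_ne_top _ _) h1
  have hDB : ∀ y ∈ B, ∀ y' ∈ B, D (nndist y y') ≤ 1 / 2 := fun y hy y' hy' => by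
    refine (hDm ?_).trans hDs₀
    rw [← NNReal.coe_le_coe, coe_nndist]
    have := dist_triangle_right y y' z
    rw [hB, Metric.mem_ball] at hy hy'
    linarith
  -- Near pairs contract in a single step.
  have step : ∀ (f : X → ℝ) (a : ℝ), 0 ≤ a → BddMeasurable f → GaugeLipschitzOn D K a f →
      ∀ x ∈ K, ∀ x' ∈ K, D (nndist x x') < 1 →
      |markovOp S ℓ f x - markovOp S ℓ f x'| ≤ q * a * D (nndist x x') := by
    intro f a ha hfb hf x hx x' hx' hlt
    obtain ⟨h1, h2, h3⟩ := hcoup ⟨x, hx⟩ ⟨x', hx'⟩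
    refine (hf.abs_markovOp_sub_le_of_coupling (r := r) (g := g) hS hfwd hD0 hD1 hDm ha hfb hx hx'
      (hR.comp (measurable_prodMk_left.comp measurable_prodMk_left))
      (hR'.comp (measurable_prodMk_left.comp measurable_prodMk_left)) h1 h2 h3).trans ?_
    calc _ ≤ a * (q * D (nndist x x')) := mul_le_mul_of_nonneg_left (hDq _ hlt) ha
      _ = _ := by ring
  -- The constant never grows: near pairs contract, and where the gauge equals `1` the oscillation
  -- bound suffices.
  have keep : ∀ (f : X → ℝ) (a : ℝ), 0 ≤ a → BddMeasurable f → GaugeLipschitzOn D K a f →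
      ∀ n, GaugeLipschitzOn D K a ((markovOp S ℓ)^[n] f) := by
    intro f a ha hfb hf n
    induction n with
    | zero => exact hf
    | succ n ih =>
      intro x hx x' hx'
      rcases (hD1 (nndist x x')).lt_or_eq with hlt | heq
      · rw [Function.iterate_succ_apply']
        refine (step _ a ha (hfb.markovOp_iterate hS ℓ n) ih x hx x' hx' hlt).trans ?_
        have := mul_nonneg ha (hD0 (nndist x x'))
        nlinarith
      · rw [heq, mul_one]
        exact hf.abs_markovOp_iterate_sub_le hS hfwd hD1 ha hfb _ hx hx'
  -- A common factor for the near and the far case; the `1/2` only ensures `α > 0`, as `q` may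
  -- vanish.
  obtain ⟨α, hα0, hα1, hαq, hαp⟩ : ∃ α : ℝ, 0 < α ∧ α < 1 ∧ q ≤ α ∧ 1 - (p : ℝ) ^ 2 / 2 ≤ α :=
    ⟨max (max q (1 / 2)) (1 - (p : ℝ) ^ 2 / 2), by simp,
      max_lt (max_lt hq1 (by norm_num)) (by nlinarith), by simp, le_max_right _ _⟩
  have contr : ∀ (f : X → ℝ) (a : ℝ), 0 ≤ a → BddMeasurable f → GaugeLipschitzOn D K a f →
      GaugeLipschitzOn D K (α * a) ((markovOp S ℓ)^[m] f) := by
    intro f a ha hfb hf x hx x' hx'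
    rcases (hD1 (nndist x x')).lt_or_eq with hlt | heq
    · obtain ⟨k, rfl⟩ := Nat.exists_eq_add_of_le' hm1
      rw [Function.iterate_succ_apply']
      refine (step _ a ha (hfb.markovOp_iterate hS ℓ k) (keep f a ha hfb hf k)
        x hx x' hx' hlt).trans ?_
      exact mul_le_mul_of_nonneg_right (mul_le_mul_of_nonneg_right hαq ha) (hD0 _)
    · rw [heq, mul_one]
      exact (hf.abs_markovOp_iterate_sub_le_of_hitting hS hfwd hD1 ha hfb m
        measurableSet_ball hDB hp0'.le hpB hx hx').trans (mul_le_mul_of_nonneg_right hαp ha)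
  have iter : ∀ (k : ℕ) (f : X → ℝ) (a : ℝ), 0 ≤ a → BddMeasurable f → GaugeLipschitzOn D K a f →
      GaugeLipschitzOn D K (α ^ k * a) ((markovOp S ℓ)^[m * k] f) := by
    intro k f a ha hfb hf
    induction k with
    | zero => simpa using hf
    | succ k ih =>
      rw [show m * (k + 1) = m + m * k by ring, Function.iterate_add_apply, pow_succ', mul_assoc]
      exact contr _ _ (by positivity) (hfb.markovOp_iterate hS ℓ _) ih
  obtain ⟨C, q', hC, hq'0, hq'1, hq'⟩ := exists_pow_div_le hα0 hα1 hm1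
  refine ⟨2 * C, q', by positivity, hq'0, hq'1, fun f A hfm hfA hfl n x hx x' hx' => ?_⟩
  have hA : 0 ≤ A := (abs_nonneg _).trans (hfA x)
  have hfb : BddMeasurable f := ⟨hfm, A, hfA⟩
  -- The sup bound gives oscillation at most `2 A`, and `min (dist y y') 1` is dominated by the
  -- gauge.
  have hf : GaugeLipschitzOn D K (2 * A) f := fun y hy y' hy' => by
    have h1 := hfl y hy y' hy'
    have h2 : |f y - f y'| ≤ 2 * A := by
      have := abs_sub (f y) (f y'); linarith [hfA y, hfA y']
    have h3 : |f y - f y'| ≤ 2 * A * min (dist y y') 1 := by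
      rcases min_cases (dist y y') 1 with h | h <;> rw [h.1]
      · nlinarith [mul_nonneg hA (dist_nonneg (x := y) (y := y'))]
      · linarith
    exact h3.trans (mul_le_mul_of_nonneg_left (hDs (nndist y y')) (by positivity))
  have h := (iter (n / m) _ _ (by positivity) (hfb.markovOp_iterate hS ℓ (n % m))
    (keep f _ (by positivity) hfb hf (n % m))).abs_sub_le hD1 (by positivity) hx hx'
  rw [← Function.iterate_add_apply, Nat.div_add_mod] at h
  refine h.trans ?_
  have := mul_le_mul_of_nonneg_right (hq' n) (by positivity : 0 ≤ 2 * A)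
  linarith

end Contraction


/-! ### Attainable sets and their compactness -/

section Attainable

variable {X : Type*} {Z : Type*} {S : X × Z → X} {E : Set Z} {Y : Set X}

lemma orbit_congr {ζ ζ' : ℕ → Z} (x : X) {n : ℕ} (h : ∀ i < n, ζ i = ζ' i) :
    orbit S x ζ n = orbit S x ζ' n := by
  induction n with
  | zero => rfl
  | succ n ih => rw [orbit, orbit, ih fun i hi => h i (hi.trans n.lt_succ_self), h n n.lt_succ_self]

lemma orbit_mem_of_forall_mem {K : Set X} (hK : ∀ x ∈ K, ∀ z ∈ E, S (x, z) ∈ K)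
    {ζ : ℕ → Z} (hζ : ∀ i, ζ i ∈ E) {x : X} (hx : x ∈ K) (n : ℕ) : orbit S x ζ n ∈ K := by
  induction n with
  | zero => exact hx
  | succ n ih => exact hK _ ih _ (hζ n)

lemma attainable_zero (hE : E.Nonempty) : attainable S E Y 0 = Y := by
  obtain ⟨e, -⟩ := hE
  ext y
  constructor
  · rintro ⟨x, hx, ζ, -, rfl⟩; exact hx
  · exact fun hy => ⟨y, hy, fun _ => e, by simp, rfl⟩

lemma attainable_succ (n : ℕ) :
    attainable S E Y (n + 1) = S '' (attainable S E Y n ×ˢ E) := by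
  ext y
  constructor
  · rintro ⟨x, hx, ζ, hζ, rfl⟩
    exact ⟨(orbit S x ζ n, ζ n), ⟨⟨x, hx, ζ, fun i hi => hζ i (hi.trans n.lt_succ_self), rfl⟩,
      hζ n n.lt_succ_self⟩, rfl⟩
  · rintro ⟨⟨_, e⟩, ⟨⟨x, hx, ζ, hζ, rfl⟩, he⟩, rfl⟩
    refine ⟨x, hx, Function.update ζ n e, fun i hi => ?_, ?_⟩
    · rcases (Nat.lt_succ_iff_lt_or_eq.1 hi) with h | rfl
      · rw [Function.update_of_ne h.ne]; exact hζ i h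
      · simpa using he
    · have : orbit S x (Function.update ζ n e) n = orbit S x ζ n :=
        orbit_congr x fun i hi => Function.update_of_ne hi.ne _ _
      rw [orbit, this, Function.update_self]

lemma attainable_mono {Y' : Set X} (h : Y ⊆ Y') (n : ℕ) :
    attainable S E Y n ⊆ attainable S E Y' n := by
  rintro _ ⟨x, hx, ζ, hζ, rfl⟩
  exact ⟨x, h hx, ζ, hζ, rfl⟩

variable [TopologicalSpace X]

lemma attainableInf_mono {Y' : Set X} (h : Y ⊆ Y') :
    attainableInf S E Y ⊆ attainableInf S E Y' :=
  closure_mono (Set.iUnion_mono (attainable_mono h))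

lemma subset_attainableInf (hE : E.Nonempty) : Y ⊆ attainableInf S E Y := by
  refine Set.Subset.trans ?_ (subset_closure.trans' (Set.subset_iUnion _ 0))
  rw [attainable_zero hE]

variable [TopologicalSpace Z]

lemma isCompact_attainable (hS : Continuous S) (hE : IsCompact E) (hE0 : E.Nonempty)
    (hY : IsCompact Y) (n : ℕ) : IsCompact (attainable S E Y n) := by
  induction n with
  | zero => rwa [attainable_zero hE0]
  | succ n ih => rw [attainable_succ]; exact (ih.prod hE).image hS

lemma map_mem_attainableInf (hS : Continuous S) {x : X} (hx : x ∈ attainableInf S E Y) {z : Z}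
    (hz : z ∈ E) : S (x, z) ∈ attainableInf S E Y := by
  refine map_mem_closure (f := fun x => S (x, z)) (by fun_prop) hx fun y hy => ?_
  obtain ⟨n, hn⟩ := Set.mem_iUnion.1 hy
  refine Set.mem_iUnion.2 ⟨n + 1, ?_⟩
  rw [attainable_succ]
  exact ⟨(y, z), ⟨hn, hz⟩, rfl⟩

end Attainable

section Metric

variable {X : Type*} {Z : Type*} [MetricSpace X] {S : X × Z → X} {E : Set Z} {Y : Set X}

lemma isCompact_attainableInf [TopologicalSpace Z] (hS : Continuous S) (hE : IsCompact E)
    (hE0 : E.Nonempty) (hY : IsCompact Y) {Y' : Set X} (hY' : IsCompact Y')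
    (h : ∀ ε > 0, ∃ N, ∀ n ≥ N, attainable S E Y' n ⊆ Metric.thickening ε Y) :
    IsCompact (attainableInf S E Y') := by
  -- Finitely many members of a cover contain a neighbourhood of `Y`, hence all late attainable
  -- sets; the finitely many early ones are compact.
  have hC : IsCompact (Y ∪ ⋃ n, attainable S E Y' n) := by
    refine isCompact_of_finite_subcover fun {ι} U hU hcov => ?_
    classical
    obtain ⟨t₁, ht₁⟩ := hY.elim_finite_subcover U hU (Set.subset_union_left.trans hcov)
    obtain ⟨δ, hδ, hδU⟩ := hY.exists_thickening_subset_open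
      (isOpen_biUnion fun i _ => hU i) ht₁
    obtain ⟨N, hN⟩ := h δ hδ
    have hB : IsCompact (⋃ n ∈ Finset.range N, attainable S E Y' n) :=
      (Finset.range N).isCompact_biUnion fun n _ => isCompact_attainable hS hE hE0 hY' n
    obtain ⟨t₂, ht₂⟩ := hB.elim_finite_subcover U hU
      ((Set.iUnion₂_subset fun n _ => Set.subset_iUnion _ n).trans
        (Set.subset_union_right.trans hcov))
    refine ⟨t₁ ∪ t₂, ?_⟩
    rw [Finset.set_biUnion_union]
    refine Set.union_subset (ht₁.trans Set.subset_union_left) (Set.iUnion_subset fun n => ?_)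
    rcases lt_or_ge n N with hn | hn
    · refine Set.Subset.trans ?_ (ht₂.trans Set.subset_union_right)
      exact Set.subset_biUnion_of_mem (u := fun n => attainable S E Y' n)
        (Finset.mem_coe.2 (Finset.mem_range.2 hn))
    · exact ((hN n hn).trans hδU).trans Set.subset_union_left
  exact hC.of_isClosed_subset isClosed_closure
    (closure_minimal Set.subset_union_right hC.isClosed)

/-- Attracting sets make attainable sets from compact sets precompact. -/
lemma AsymptoticCompactness.isCompact_attainableInf [MeasurableSpace X] [TopologicalSpace Z]
    (hAC : AsymptoticCompactness S E Y) (hS : Continuous S) (hE : IsCompact E)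
    (hE0 : E.Nonempty) (hY0 : Y.Nonempty) {Y' : Set X} (hY' : IsCompact Y') :
    IsCompact (attainableInf S E Y') := by
  obtain ⟨hY, κ, hκ, V, -, hV, hbd⟩ := hAC
  refine RDS.isCompact_attainableInf hS hE hE0 hY hY' fun ε hε => ?_
  obtain ⟨C, hC⟩ := hV Y' hY'.isBounded
  have hlim : Tendsto (fun n : ℕ => (C : ℝ) * Real.exp (-κ * n)) atTop (𝓝 (C * 0)) := by
    refine (Real.tendsto_exp_atBot.comp ?_).const_mul _
    exact tendsto_natCast_atTop_atTop.const_mul_atTop_of_neg (by linarith)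
  rw [mul_zero] at hlim
  obtain ⟨N, hN⟩ := eventually_atTop.1
    ((hlim.eventually (eventually_lt_nhds hε)).and (eventually_ge_atTop 1))
  refine ⟨N, fun n hn => ?_⟩
  rintro _ ⟨x, hx, ζ, hζ, rfl⟩
  obtain ⟨e, he⟩ := hE0
  -- (AC) speaks of sequences lying entirely in `E`; inputs from time `n` on do not affect the orbit
  -- at time `n` and are replaced by a fixed `e ∈ E`.
  rw [orbit_congr (ζ' := fun i => if i < n then ζ i else e) x fun i hi => by simp [hi]]
  rw [Metric.mem_thickening_iff, ← Metric.infDist_lt_iff hY0]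
  refine (hbd x _ (fun i => ?_) n (hN n hn).2).trans_lt
    (lt_of_le_of_lt ?_ (hN n hn).1)
  · split_ifs with h
    exacts [hζ i h, he]
  · exact mul_le_mul_of_nonneg_right (NNReal.coe_le_coe.2 (hC x hx)) (Real.exp_pos _).le

lemma dist_orbit_le [PseudoMetricSpace Z] {K : Set X} (hK : ∀ x ∈ K, ∀ z ∈ E, S (x, z) ∈ K)
    {L : ℝ≥0} (hL : LipschitzOnWith L S (K ×ˢ E)) {ζ : ℕ → Z} (hζ : ∀ i, ζ i ∈ E) {x x' : X}
    (hx : x ∈ K) (hx' : x' ∈ K) (n : ℕ) :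
    dist (orbit S x ζ n) (orbit S x' ζ n) ≤ L ^ n * dist x x' := by
  induction n with
  | zero => simp [orbit]
  | succ n ih =>
    refine (hL.dist_le_mul _ ⟨orbit_mem_of_forall_mem hK hζ hx n, hζ n⟩ _
      ⟨orbit_mem_of_forall_mem hK hζ hx' n, hζ n⟩).trans ?_
    rw [Prod.dist_eq, dist_self, max_eq_left dist_nonneg, pow_succ', mul_assoc]
    gcongr

end Metric

/-! ### Mixing transferred from the attractor to a larger compact set -/

section Mixing

variable {X : Type*} {Z : Type*} [MeasurableSpace Z] {ℓ : Measure Z} [IsProbabilityMeasure ℓ]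

lemma ae_forall_mem_infinitePi {E : Set Z} (hE : ∀ᵐ z ∂ℓ, z ∈ E) :
    ∀ᵐ ζ ∂(Measure.infinitePi fun _ : ℕ => ℓ), ∀ i, ζ i ∈ E :=
  ae_all_iff.2 fun i =>
    (measurePreserving_eval_infinitePi (fun _ : ℕ => ℓ) i).quasiMeasurePreserving.ae hE

lemma ae_transition_mem [MeasurableSpace X] {S : X × Z → X} {E : Set Z} {K : Set X}
    (hE : ∀ᵐ z ∂ℓ, z ∈ E) (hS : Measurable S) (hK : ∀ x ∈ K, ∀ z ∈ E, S (x, z) ∈ K)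
    (hKm : MeasurableSet K) (n : ℕ) {x : X} (hx : x ∈ K) :
    ∀ᵐ y ∂(transition S ℓ n x), y ∈ K := by
  rw [transition]
  refine (ae_map_iff (measurable_orbit_right hS x n).aemeasurable hKm).2 ?_
  filter_upwards [ae_forall_mem_infinitePi hE] with ζ hζ
  exact orbit_mem_of_forall_mem hK hζ hx n

variable [MetricSpace X] [MeasurableSpace X]
  {S : X × Z → X}

lemma abs_markovOp_iterate_sub_le_of_lipschitz [PseudoMetricSpace Z] {E : Set Z} {K : Set X}
    (hE : ∀ᵐ z ∂ℓ, z ∈ E) (hS : Measurable S)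
    (hK : ∀ x ∈ K, ∀ z ∈ E, S (x, z) ∈ K) {L : ℝ≥0} (hL : LipschitzOnWith L S (K ×ˢ E))
    {f : X → ℝ} {A : ℝ} (hA : 0 ≤ A) (hf : BddMeasurable f)
    (hfl : ∀ x ∈ K, ∀ x' ∈ K, |f x - f x'| ≤ A * dist x x') (n : ℕ) {x x' : X} (hx : x ∈ K)
    (hx' : x' ∈ K) :
    |(markovOp S ℓ)^[n] f x - (markovOp S ℓ)^[n] f x'| ≤ A * (L ^ n * dist x x') := by
  rw [← integral_orbit hS ℓ hf, ← integral_orbit hS ℓ hf,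
    ← integral_sub (hf.integrable (measurable_orbit_right hS x n))
      (hf.integrable (measurable_orbit_right hS x' n)), ← Real.norm_eq_abs]
  refine (norm_integral_le_of_norm_le_const (C := A * (L ^ n * dist x x')) ?_).trans (by simp)
  filter_upwards [ae_forall_mem_infinitePi hE] with ζ hζ
  refine (hfl _ (orbit_mem_of_forall_mem hK hζ hx n) _
    (orbit_mem_of_forall_mem hK hζ hx' n)).trans ?_
  gcongr
  exact dist_orbit_le hK hL hζ hx hx' n

/-- Exponential decay of oscillations on a compact invariant set attracted by a set on which
oscillations decay exponentially. -/
theorem exists_exp_decay_osc_of_attracted [PseudoMetricSpace Z] {E : Set Z} {K Y : Set X}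
    (hE : ∀ᵐ z ∂ℓ, z ∈ E) (hS : Measurable S) (hKc : IsCompact K)
    (hK : ∀ x ∈ K, ∀ z ∈ E, S (x, z) ∈ K) {L : ℝ≥0} (hL : LipschitzOnWith L S (K ×ˢ E))
    (hY : IsCompact Y) (hY0 : Y.Nonempty) (hYK : Y ⊆ K)
    {κ M : ℝ} (hκ : 0 < κ) (hM : ∀ x ∈ K, ∀ ζ : ℕ → Z, (∀ i, ζ i ∈ E) → ∀ n : ℕ, 1 ≤ n →
      Metric.infDist (orbit S x ζ n) Y ≤ M * Real.exp (-κ * n))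
    {C q : ℝ} (hC : 0 ≤ C) (hq0 : 0 < q) (hq1 : q < 1)
    (hmix : ∀ (f : X → ℝ) (A : ℝ), Measurable f → (∀ x, |f x| ≤ A) →
      (∀ x ∈ K, ∀ x' ∈ K, |f x - f x'| ≤ A * dist x x') → ∀ n, ∀ x ∈ Y, ∀ x' ∈ Y,
        |(markovOp S ℓ)^[n] f x - (markovOp S ℓ)^[n] f x'| ≤ A * (C * q ^ n)) :
    ∃ C q : ℝ, 0 ≤ C ∧ 0 < q ∧ q < 1 ∧ ∀ (f : X → ℝ) (A : ℝ), Measurable f → (∀ x, |f x| ≤ A) →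
      (∀ x ∈ K, ∀ x' ∈ K, |f x - f x'| ≤ A * dist x x') → ∀ n, ∀ x ∈ K, ∀ x' ∈ K,
        |(markovOp S ℓ)^[n] f x - (markovOp S ℓ)^[n] f x'| ≤ A * (C * q ^ n) := by
  obtain ⟨y₀, hy₀⟩ := hY0
  obtain ⟨L', hL'0, hLL', hL'⟩ : ∃ L' : ℝ≥0, 0 < L' ∧ L ≤ L' ∧ LipschitzOnWith L' S (K ×ˢ E) :=
    ⟨L + 1, by positivity, le_self_add, hL.weaken le_self_add⟩
  obtain ⟨M', hM'0, hM'⟩ : ∃ M' : ℝ, 0 ≤ M' ∧ ∀ x ∈ K, ∀ ζ : ℕ → Z, (∀ i, ζ i ∈ E) → ∀ n : ℕ,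
      Metric.infDist (orbit S x ζ n) Y ≤ M' * Real.exp (-κ * n) := by
    refine ⟨max M (Metric.diam K), le_max_of_le_right Metric.diam_nonneg,
      fun x hx ζ hζ n => ?_⟩
    rcases Nat.eq_zero_or_pos n with rfl | hn
    · refine le_trans ?_ (mul_le_mul_of_nonneg_right (le_max_right _ _) (Real.exp_pos _).le)
      simpa [orbit] using (Metric.infDist_le_dist_of_mem hy₀).trans
        (Metric.dist_le_diam_of_mem hKc.isBounded hx (hYK hy₀))
    · exact (hM x hx ζ hζ n hn).trans
        (mul_le_mul_of_nonneg_right (le_max_left _ _) (Real.exp_pos _).le)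
  -- Each of the `m` final steps may expand distances by `L'`; `c` steps of attraction per expanding
  -- step outweigh this.
  obtain ⟨c, hc1, hc⟩ : ∃ c : ℕ, 1 ≤ c ∧ L' * Real.exp (-κ * c) ≤ 1 / 2 := by
    obtain ⟨n, hn⟩ := exists_pow_lt_of_lt_one (show (0 : ℝ) < 1 / (2 * L') by positivity)
      (Real.exp_lt_one_iff.2 (show -κ < 0 by linarith))
    refine ⟨n + 1, by omega, ?_⟩
    have h1 : Real.exp (-κ * (n + 1 : ℕ)) ≤ 1 / (2 * L') := by
      refine le_trans ?_ hn.le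
      rw [← Real.exp_nat_mul]
      exact Real.exp_le_exp.2 (by push_cast; nlinarith)
    calc _ ≤ (L' : ℝ) * (1 / (2 * L')) := by gcongr
      _ = 1 / 2 := by field_simp
  set ρ := max q (1 / 2) with hρ
  have hρ0 : 0 < ρ := by positivity
  have hρ1 : ρ < 1 := max_lt hq1 (by norm_num)
  obtain ⟨C', q', hC', hq'0, hq'1, hq'⟩ := exists_pow_div_le hρ0 hρ1 (m := c + 1) (by omega)
  refine ⟨2 * ((M' + C) * C'), q', by positivity, hq'0, hq'1, fun f A hfm hfA hfl N => ?_⟩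
  have hA : 0 ≤ A := (abs_nonneg _).trans (hfA y₀)
  have hfb : BddMeasurable f := ⟨hfm, A, hfA⟩
  set m := N / (c + 1) with hm
  -- Time `N = n + m`: attraction during the first `n ≥ c m` steps, mixing during the last `m`.
  obtain ⟨n, hn, hcn⟩ : ∃ n, N = n + m ∧ c * m ≤ n := by
    have : (c + 1) * m ≤ N := Nat.mul_div_le N (c + 1)
    refine ⟨N - m, ?_, ?_⟩
    · have : m ≤ N := Nat.div_le_self _ _
      omega
    · have : (c + 1) * m = c * m + m := by ring
      omega
  -- Every starting point is compared with the one reference value `T^m f (y₀)`, through the point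
  -- of `Y` nearest to the orbit at time `n`.
  have key : ∀ x ∈ K, |(markovOp S ℓ)^[N] f x - (markovOp S ℓ)^[m] f y₀| ≤
      A * ((M' + C) * C' * q' ^ N) := by
    intro x hx
    have hfm := hfb.markovOp_iterate hS ℓ m
    have : ∫ ζ, ((markovOp S ℓ)^[m] f (orbit S x ζ n) - (markovOp S ℓ)^[m] f y₀)
        ∂(Measure.infinitePi fun _ : ℕ => ℓ) =
        (markovOp S ℓ)^[N] f x - (markovOp S ℓ)^[m] f y₀ := by
      rw [integral_sub (hfm.integrable (measurable_orbit_right hS x n)) (integrable_const _),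
        integral_orbit hS ℓ hfm, hn, Function.iterate_add_apply]
      simp
    rw [← this, ← Real.norm_eq_abs]
    refine (norm_integral_le_of_norm_le_const (C := A * ((M' + C) * ρ ^ m)) ?_).trans ?_
    · filter_upwards [ae_forall_mem_infinitePi hE] with ζ hζ
      obtain ⟨y, hy, hdy⟩ := hY.exists_infDist_eq_dist ⟨y₀, hy₀⟩ (orbit S x ζ n)
      have hd := hM' x hx ζ hζ n
      rw [hdy] at hd
      have h1 := abs_markovOp_iterate_sub_le_of_lipschitz hE hS hK hL' hA hfb hfl m
        (orbit_mem_of_forall_mem hK hζ hx n) (hYK hy)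
      have h2 := hmix f A hfb.measurable hfA hfl m y hy y₀ hy₀
      have h3 : (L' : ℝ) ^ m * dist (orbit S x ζ n) y ≤ M' * ρ ^ m := by
        have h4 : Real.exp (-κ * n) ≤ Real.exp (-κ * c) ^ m := by
          rw [← Real.exp_nat_mul]
          refine Real.exp_le_exp.2 ?_
          have : (c : ℝ) * m ≤ n := by exact_mod_cast hcn
          nlinarith
        calc (L' : ℝ) ^ m * dist (orbit S x ζ n) y
            ≤ (L' : ℝ) ^ m * (M' * Real.exp (-κ * c) ^ m) := by
              gcongr; exact hd.trans (by gcongr)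
          _ = M' * (L' * Real.exp (-κ * c)) ^ m := by rw [mul_pow]; ring
          _ ≤ M' * ρ ^ m := by
              gcongr
              exact hc.trans (le_max_right _ _)
      have h5 : C * q ^ m ≤ C * ρ ^ m := by
        gcongr; exact le_max_left _ _
      rw [Real.norm_eq_abs]
      refine (abs_sub_le _ ((markovOp S ℓ)^[m] f y) _).trans ?_
      calc _ ≤ A * (M' * ρ ^ m) + A * (C * ρ ^ m) := by
            refine add_le_add (h1.trans ?_) (h2.trans ?_) <;> gcongr
        _ = _ := by ring
    · simp only [probReal_univ, mul_one]
      have := hq' N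
      calc A * ((M' + C) * ρ ^ m) ≤ A * ((M' + C) * (C' * q' ^ N)) := by gcongr
        _ = _ := by ring
  intro x hx x' hx'
  have h1 := key x hx
  have h2 := key x' hx'
  rw [abs_sub_comm] at h2
  refine (abs_sub_le _ ((markovOp S ℓ)^[m] f y₀) _).trans ?_
  linarith

end Mixing


/-! ### The Markov operator on continuous functions and the Poisson equation -/

/-- Random continuous self-maps of `K` with parameter in `Z`. -/
structure RandomMap (K Z : Type*) [TopologicalSpace K] [MeasurableSpace K]
    [MeasurableSpace Z] where
  toFun : K × Z → K
  measurable : Measurable toFun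
  continuous_left : ∀ z, Continuous fun x => toFun (x, z)

namespace RandomMap

variable {K Z : Type*} [MetricSpace K] [CompactSpace K] [MeasurableSpace K] [BorelSpace K]
  [MeasurableSpace Z] (s : RandomMap K Z) (ℓ : Measure Z) [IsProbabilityMeasure ℓ]
  {𝕜 : Type*} [RCLike 𝕜]

lemma _root_.ContinuousMap.bddMeasurable (h : C(K, 𝕜)) : BddMeasurable (h : K → 𝕜) :=
  ⟨h.continuous.measurable, ‖h‖, h.norm_coe_le_norm⟩

lemma integrable_comp (h : C(K, 𝕜)) (x : K) : Integrable (fun z => h (s.toFun (x, z))) ℓ :=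
  h.bddMeasurable.integrable (s.measurable.comp measurable_prodMk_left)

variable (𝕜) in
/-- The Markov operator acting on continuous functions. -/
noncomputable def op : C(K, 𝕜) →L[𝕜] C(K, 𝕜) :=
  LinearMap.mkContinuous
    { toFun := fun h => ⟨markovOp s.toFun ℓ h,
        continuous_of_dominated (fun x => (s.integrable_comp ℓ h x).aestronglyMeasurable)
          (fun x => .of_forall fun z => h.norm_coe_le_norm _) (integrable_const ‖h‖)
          (.of_forall fun z => h.continuous.comp (s.continuous_left z))⟩
      map_add' := fun h h' => by
        ext x
        exact integral_add (s.integrable_comp ℓ h x) (s.integrable_comp ℓ h' x)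
      map_smul' := fun c h => by
        ext x
        exact integral_const_mul c fun z => h (s.toFun (x, z)) }
    1 fun h => by
      rw [one_mul]
      refine (ContinuousMap.norm_le _ (norm_nonneg h)).2 fun x => ?_
      exact (norm_integral_le_of_norm_le_const (μ := ℓ)
        (.of_forall fun z => h.norm_coe_le_norm (s.toFun (x, z)))).trans (by simp)

lemma op_apply (h : C(K, 𝕜)) (x : K) : s.op ℓ 𝕜 h x = ∫ z, h (s.toFun (x, z)) ∂ℓ := rfl

lemma coe_op (h : C(K, 𝕜)) : ⇑(s.op ℓ 𝕜 h) = markovOp s.toFun ℓ h := rfl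

lemma norm_op_le (h : C(K, 𝕜)) : ‖s.op ℓ 𝕜 h‖ ≤ ‖h‖ := by
  simpa using (s.op ℓ 𝕜).le_of_opNorm_le (LinearMap.mkContinuous_norm_le _ zero_le_one _) h

lemma norm_op_iterate_le (h : C(K, 𝕜)) (n : ℕ) : ‖(s.op ℓ 𝕜)^[n] h‖ ≤ ‖h‖ := by
  induction n with
  | zero => exact le_rfl
  | succ n ih => rw [Function.iterate_succ_apply']; exact (s.norm_op_le ℓ _).trans ih

@[simp] lemma op_const (c : 𝕜) : s.op ℓ 𝕜 (ContinuousMap.const K c) = ContinuousMap.const K c := by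
  ext x; simp [op_apply]

lemma op_iterate_const (c : 𝕜) (n : ℕ) :
    (s.op ℓ 𝕜)^[n] (ContinuousMap.const K c) = ContinuousMap.const K c :=
  Function.iterate_fixed (s.op_const ℓ c) n

lemma op_iterate_sub (h h' : C(K, 𝕜)) (n : ℕ) :
    (s.op ℓ 𝕜)^[n] (h - h') = (s.op ℓ 𝕜)^[n] h - (s.op ℓ 𝕜)^[n] h' := by
  induction n with
  | zero => rfl
  | succ n ih => simp only [Function.iterate_succ_apply', ih, map_sub]

lemma coe_op_iterate (h : C(K, 𝕜)) (n : ℕ) :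
    ⇑((s.op ℓ 𝕜)^[n] h) = (markovOp s.toFun ℓ)^[n] h := by
  induction n with
  | zero => rfl
  | succ n ih => rw [Function.iterate_succ_apply', Function.iterate_succ_apply', coe_op, ih]

lemma coe_mul_op_iterate (w h : C(K, 𝕜)) (n : ℕ) :
    ⇑((fun f => w * s.op ℓ 𝕜 f)^[n] h) =
      (fun (f : K → 𝕜) x => w x * markovOp s.toFun ℓ f x)^[n] h := by
  induction n with
  | zero => rfl
  | succ n ih =>
    rw [Function.iterate_succ_apply', Function.iterate_succ_apply', ContinuousMap.coe_mul,
      coe_op, ih]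
    rfl

lemma integral_prod_mul (w h : C(K, 𝕜)) (n : ℕ) (x : K) :
    ∫ ζ, (∏ k ∈ Finset.range n, w (orbit s.toFun x ζ k)) * h (orbit s.toFun x ζ n)
        ∂(Measure.infinitePi fun _ : ℕ => ℓ) = (fun f => w * s.op ℓ 𝕜 f)^[n] h x := by
  rw [coe_mul_op_iterate, integral_prod_mul_orbit s.measurable ℓ w.bddMeasurable h.bddMeasurable]

lemma op_mono {h h' : C(K, ℝ)} (hh : ∀ x, h x ≤ h' x) (x : K) : s.op ℓ ℝ h x ≤ s.op ℓ ℝ h' x :=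
  integral_mono (s.integrable_comp ℓ h x) (s.integrable_comp ℓ h' x) fun _ => hh _

lemma op_iterate_nonneg {h : C(K, ℝ)} (hh : ∀ x, 0 ≤ h x) (n : ℕ) (x : K) :
    0 ≤ (s.op ℓ ℝ)^[n] h x := by
  induction n generalizing x with
  | zero => exact hh x
  | succ n ih =>
    rw [Function.iterate_succ_apply']
    exact integral_nonneg fun z => ih _

/-- The difference is the variance of `h` after one step. -/
lemma sq_op_le_op_sq (h : C(K, ℝ)) (x : K) : s.op ℓ ℝ h x ^ 2 ≤ s.op ℓ ℝ (h ^ 2) x := by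
  set m := s.op ℓ ℝ h x with hm
  have h0 : 0 ≤ ∫ z, (h (s.toFun (x, z)) - m) ^ 2 ∂ℓ := integral_nonneg fun z => sq_nonneg _
  have h1 : ∫ z, (h (s.toFun (x, z)) - m) ^ 2 ∂ℓ =
      s.op ℓ ℝ (h ^ 2 - (2 * m) • h + ContinuousMap.const K (m ^ 2)) x := by
    rw [op_apply]
    refine integral_congr_ae (.of_forall fun z => ?_)
    simp only [ContinuousMap.add_apply, ContinuousMap.sub_apply, ContinuousMap.pow_apply,
      ContinuousMap.smul_apply, ContinuousMap.const_apply, smul_eq_mul]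
    ring
  rw [h1, map_add, map_sub, map_smul, op_const] at h0
  simp only [ContinuousMap.add_apply, ContinuousMap.sub_apply, ContinuousMap.smul_apply,
    ContinuousMap.const_apply, smul_eq_mul, ← hm] at h0
  nlinarith

/-- The complexification of a real continuous function. -/
def toComplex (h : C(K, ℝ)) : C(K, ℂ) := ⟨fun x => (h x : ℂ), by fun_prop⟩

omit [CompactSpace K] [MeasurableSpace K] [BorelSpace K] in
@[simp] lemma toComplex_apply (h : C(K, ℝ)) (x : K) : toComplex h x = (h x : ℂ) := rfl

lemma op_toComplex (h : C(K, ℝ)) : s.op ℓ ℂ (toComplex h) = toComplex (s.op ℓ ℝ h) := by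
  ext x
  simp only [op_apply, toComplex_apply]
  exact integral_ofReal

/-- The Poisson equation `φ - T φ = f`. -/
lemma exists_poisson {f : C(K, ℝ)} (hf : Summable fun n => ‖(s.op ℓ ℝ)^[n] f‖) :
    ∃ φ : C(K, ℝ), φ - s.op ℓ ℝ φ = f := by
  have hs : Summable fun n => (s.op ℓ ℝ)^[n] f := hf.of_norm
  -- Neumann series for the inverse of `1 - T`.
  refine ⟨∑' n, (s.op ℓ ℝ)^[n] f, ?_⟩
  rw [(s.op ℓ ℝ).map_tsum hs]
  simp_rw [← Function.iterate_succ_apply' (s.op ℓ ℝ)]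
  rw [hs.tsum_eq_zero_add]
  simp

/-- For merely continuous `p` there is no rate of convergence and the Neumann series may diverge;
its partial sums still solve the equation up to `T^m p - c`. -/
lemma exists_approx_poisson {p : C(K, ℝ)} {c : ℝ}
    (hp : Tendsto (fun n => (s.op ℓ ℝ)^[n] p) atTop (𝓝 (ContinuousMap.const K c)))
    {ε : ℝ} (hε : 0 < ε) :
    ∃ b : C(K, ℝ), ‖p - ContinuousMap.const K c - (b - s.op ℓ ℝ b)‖ ≤ ε := by
  obtain ⟨m, hm⟩ := ((Metric.tendsto_nhds.1 hp) ε hε).exists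
  set p' := p - ContinuousMap.const K c with hp'
  refine ⟨∑ j ∈ Finset.range m, (s.op ℓ ℝ)^[j] p', ?_⟩
  have h1 : (∑ j ∈ Finset.range m, (s.op ℓ ℝ)^[j] p') -
      s.op ℓ ℝ (∑ j ∈ Finset.range m, (s.op ℓ ℝ)^[j] p') = p' - (s.op ℓ ℝ)^[m] p' := by
    rw [map_sum, ← Finset.sum_sub_distrib]
    simp_rw [← Function.iterate_succ_apply' (s.op ℓ ℝ)]
    exact Finset.sum_range_sub' (fun j => (s.op ℓ ℝ)^[j] p') m
  rw [h1, sub_sub_cancel, hp', op_iterate_sub, op_iterate_const, ← dist_eq_norm]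
  exact hm.le

end RandomMap


/-! ### Strong law of large numbers by exponential moments -/

namespace RandomMap

variable {K Z : Type*} [MetricSpace K] [CompactSpace K] [MeasurableSpace K] [BorelSpace K]
  [MeasurableSpace Z] (s : RandomMap K Z) (ℓ : Measure Z) [IsProbabilityMeasure ℓ]

lemma exp_le_one_add_add_sq {y : ℝ} (hy : |y| ≤ 1) : Real.exp y ≤ 1 + y + y ^ 2 := by
  have := (abs_le.1 (Real.abs_exp_sub_one_sub_id_le hy)).2
  linarith

/-- Exponential moment bound for additive functionals of coboundaries. -/
lemma mul_op_exp_le (φ : C(K, ℝ)) {B a : ℝ} (hB : ‖φ‖ ≤ B) (ha : 0 ≤ a) (haB : 2 * B * a ≤ 1)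
    (x : K) :
    Real.exp (a * (φ x - s.op ℓ ℝ φ x)) * ∫ z, Real.exp (a * φ (s.toFun (x, z))) ∂ℓ ≤
      Real.exp (4 * B ^ 2 * a ^ 2) * Real.exp (a * φ x) := by
  set m := s.op ℓ ℝ φ x with hm
  have hB0 : 0 ≤ B := (norm_nonneg _).trans hB
  have hy : ∀ z, |a * (φ (s.toFun (x, z)) - m)| ≤ 2 * B * a := fun z => by
    have h1 : |φ (s.toFun (x, z))| ≤ B := (φ.norm_coe_le_norm _).trans hB
    have h2 : |m| ≤ B := ((s.op ℓ ℝ φ).norm_coe_le_norm x).trans ((s.norm_op_le ℓ φ).trans hB)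
    rw [abs_mul, abs_of_nonneg ha]
    have := abs_sub (φ (s.toFun (x, z))) m
    nlinarith
  have hint := s.integrable_comp ℓ φ x
  have hsub : Integrable (fun z => φ (s.toFun (x, z)) - m) ℓ := hint.sub (integrable_const m)
  have hle : ∫ z, Real.exp (a * (φ (s.toFun (x, z)) - m)) ∂ℓ ≤
      ∫ z, (1 + 4 * B ^ 2 * a ^ 2 + a * (φ (s.toFun (x, z)) - m)) ∂ℓ := by
    refine integral_mono_of_nonneg (.of_forall fun z => (Real.exp_pos _).le)
      ((integrable_const _).add (hsub.const_mul a)) (.of_forall fun z => ?_)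
    have h1 := exp_le_one_add_add_sq ((hy z).trans haB)
    have h2 := sq_le_sq' (by linarith [abs_le.1 (hy z)]) (abs_le.1 (hy z)).2
    dsimp only
    nlinarith
  rw [integral_add (integrable_const _) (hsub.const_mul a), integral_const_mul,
    integral_sub hint (integrable_const m), ← op_apply, ← hm] at hle
  simp only [integral_const, probReal_univ, smul_eq_mul, one_mul, sub_self, mul_zero,
    add_zero] at hle
  have h3 : ∫ z, Real.exp (a * (φ (s.toFun (x, z)) - m)) ∂ℓ ≤ Real.exp (4 * B ^ 2 * a ^ 2) := by
    linarith [Real.add_one_le_exp (4 * B ^ 2 * a ^ 2)]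
  -- Factoring out `exp (a φ x)` leaves the exponential of a centred increment, whose linear term
  -- integrates to zero.
  have h4 : Real.exp (a * (φ x - m)) * ∫ z, Real.exp (a * φ (s.toFun (x, z))) ∂ℓ =
      Real.exp (a * φ x) * ∫ z, Real.exp (a * (φ (s.toFun (x, z)) - m)) ∂ℓ := by
    rw [← integral_const_mul, ← integral_const_mul]
    refine integral_congr_ae (.of_forall fun z => ?_)
    dsimp only
    rw [← Real.exp_add, ← Real.exp_add]; ring_nf
  rw [h4, mul_comm]
  exact mul_le_mul_of_nonneg_right h3 (Real.exp_pos _).le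

omit [CompactSpace K] in
lemma measurable_sum_orbit (f : C(K, ℝ)) (x : K) (n : ℕ) :
    Measurable fun ζ : ℕ → Z => ∑ k ∈ Finset.range n, f (orbit s.toFun x ζ k) :=
  Finset.measurable_fun_sum _ fun k _ =>
    f.continuous.measurable.comp (measurable_orbit_right s.measurable x k)

omit [BorelSpace K] in
lemma abs_sum_orbit_le (f : C(K, ℝ)) (x : K) (n : ℕ) (ζ : ℕ → Z) :
    |∑ k ∈ Finset.range n, f (orbit s.toFun x ζ k)| ≤ n * ‖f‖ := by
  refine (Finset.abs_sum_le_sum_abs _ _).trans ?_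
  simpa using Finset.sum_le_card_nsmul (Finset.range n) _ ‖f‖
    fun k _ => f.norm_coe_le_norm (orbit s.toFun x ζ k)

/-- By `mul_op_exp_le`, `h = exp (a φ)` grows by at most `exp (4 B² a²)` under each application of
the weighted operator. Iterating bounds the moment weighted by `h (x_n)`; since `h` lies between
`exp (-B a)` and `exp (B a)`, removing it costs `exp (2 B a)`. -/
lemma integral_exp_sum_le (φ : C(K, ℝ)) {B a : ℝ} (hB : ‖φ‖ ≤ B) (ha : 0 ≤ a)
    (haB : 2 * B * a ≤ 1) (n : ℕ) (x : K) :
    ∫ ζ, Real.exp (a * ∑ k ∈ Finset.range n, (φ - s.op ℓ ℝ φ) (orbit s.toFun x ζ k))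
        ∂(Measure.infinitePi fun _ : ℕ => ℓ) ≤
      Real.exp (2 * B * a) * Real.exp (4 * B ^ 2 * a ^ 2) ^ n := by
  set f := φ - s.op ℓ ℝ φ with hf
  set w : C(K, ℝ) := ⟨fun x => Real.exp (a * f x), by fun_prop⟩ with hw
  set h : C(K, ℝ) := ⟨fun x => Real.exp (a * φ x), by fun_prop⟩ with hh
  have hφB : ∀ y, |φ y| ≤ B := fun y => (φ.norm_coe_le_norm y).trans hB
  have iter : ∀ n y, (fun g => w * s.op ℓ ℝ g)^[n] h y ≤
      (Real.exp (4 * B ^ 2 * a ^ 2) ^ n • h) y := by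
    intro n
    induction n with
    | zero => intro y; simp
    | succ n ih =>
      intro y
      rw [Function.iterate_succ_apply', ContinuousMap.mul_apply]
      have h1 := s.op_mono ℓ ih y
      rw [map_smul, ContinuousMap.smul_apply, smul_eq_mul] at h1
      have h2 : w y * s.op ℓ ℝ h y ≤ Real.exp (4 * B ^ 2 * a ^ 2) * h y :=
        s.mul_op_exp_le ℓ φ hB ha haB y
      have hw0 : 0 ≤ w y := (Real.exp_pos _).le
      calc _ ≤ w y * (Real.exp (4 * B ^ 2 * a ^ 2) ^ n * s.op ℓ ℝ h y) := by gcongr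
        _ = Real.exp (4 * B ^ 2 * a ^ 2) ^ n * (w y * s.op ℓ ℝ h y) := by ring
        _ ≤ Real.exp (4 * B ^ 2 * a ^ 2) ^ n * (Real.exp (4 * B ^ 2 * a ^ 2) * h y) := by gcongr
        _ = _ := by rw [ContinuousMap.smul_apply, smul_eq_mul, pow_succ]; ring
  have hbd : ∀ y, h y ≤ Real.exp (B * a) := fun y => Real.exp_le_exp.2 (by
    nlinarith [(abs_le.1 (hφB y)).2])
  have hlow : ∀ y, Real.exp (-(B * a)) ≤ h y := fun y => Real.exp_le_exp.2 (by
    nlinarith [(abs_le.1 (hφB y)).1])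
  have hprod := s.integral_prod_mul ℓ w h n x
  have hmeas : Measurable fun ζ : ℕ → Z =>
      Real.exp (a * ∑ k ∈ Finset.range n, f (orbit s.toFun x ζ k)) :=
    Real.measurable_exp.comp ((s.measurable_sum_orbit f x n).const_mul a)
  have hint : Integrable (fun ζ : ℕ → Z =>
      Real.exp (a * ∑ k ∈ Finset.range n, f (orbit s.toFun x ζ k)))
      (Measure.infinitePi fun _ : ℕ => ℓ) := by
    refine .of_bound hmeas.aestronglyMeasurable (Real.exp (a * (n * ‖f‖))) (.of_forall fun ζ => ?_)
    rw [Real.norm_of_nonneg (Real.exp_pos _).le]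
    exact Real.exp_le_exp.2 (mul_le_mul_of_nonneg_left
      ((le_abs_self _).trans (s.abs_sum_orbit_le f x n ζ)) ha)
  have hp : ∀ ζ : ℕ → Z, ∏ k ∈ Finset.range n, w (orbit s.toFun x ζ k) =
      Real.exp (a * ∑ k ∈ Finset.range n, f (orbit s.toFun x ζ k)) := fun ζ => by
    rw [Finset.mul_sum, Real.exp_sum]; rfl
  simp_rw [hp] at hprod
  have h1 : (∫ ζ, Real.exp (a * ∑ k ∈ Finset.range n, f (orbit s.toFun x ζ k))
        ∂(Measure.infinitePi fun _ : ℕ => ℓ)) * Real.exp (-(B * a)) ≤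
      Real.exp (4 * B ^ 2 * a ^ 2) ^ n * Real.exp (B * a) := by
    rw [← integral_mul_const]
    refine (integral_mono (hint.mul_const _) ?_ fun ζ => ?_).trans (hprod.le.trans
      ((iter n x).trans ?_))
    · exact hint.mul_bdd (c := ‖h‖)
        (h.continuous.measurable.comp (measurable_orbit_right s.measurable x n)).aestronglyMeasurable
        (.of_forall fun ζ => h.norm_coe_le_norm _)
    · exact mul_le_mul_of_nonneg_left (hlow _) (Real.exp_pos _).le
    · rw [ContinuousMap.smul_apply, smul_eq_mul]
      exact mul_le_mul_of_nonneg_left (hbd x) (by positivity)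
  rw [Real.exp_neg, ← div_eq_mul_inv, div_le_iff₀ (Real.exp_pos _)] at h1
  refine h1.trans (le_of_eq ?_)
  rw [mul_assoc, ← Real.exp_add, mul_comm]
  ring_nf

/-- One-sided strong law of large numbers for coboundaries. -/
lemma ae_eventually_sum_lt (φ : C(K, ℝ)) (x : K) {ε : ℝ} (hε : 0 < ε) :
    ∀ᵐ ζ ∂(Measure.infinitePi fun _ : ℕ => ℓ), ∀ᶠ n : ℕ in atTop,
      ∑ k ∈ Finset.range n, (φ - s.op ℓ ℝ φ) (orbit s.toFun x ζ k) < n * ε := by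
  set f := φ - s.op ℓ ℝ φ with hf
  set B := ‖φ‖ + 1 with hB
  have hB0 : 0 < B := by positivity
  -- With this `a` the quadratic cost `4 B² a²` is at most half the Chernoff gain `a ε`, so the
  -- deviation probabilities are summable.
  obtain ⟨a, ha, haB, haε⟩ : ∃ a : ℝ, 0 < a ∧ 2 * B * a ≤ 1 ∧ 8 * B ^ 2 * a ≤ ε := by
    refine ⟨min (1 / (2 * B)) (ε / (8 * B ^ 2)), by positivity, ?_, ?_⟩
    · calc _ ≤ 2 * B * (1 / (2 * B)) := by gcongr; exact min_le_left _ _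
        _ = 1 := by field_simp
    · calc _ ≤ 8 * B ^ 2 * (ε / (8 * B ^ 2)) := by gcongr; exact min_le_right _ _
        _ = ε := by field_simp
  set ν := Measure.infinitePi fun _ : ℕ => ℓ
  set A : ℕ → Set (ℕ → Z) := fun n =>
    {ζ | n * ε ≤ ∑ k ∈ Finset.range n, f (orbit s.toFun x ζ k)} with hA
  have hbound : ∀ n, ν (A n) ≤
      ENNReal.ofReal (Real.exp (2 * B * a) * Real.exp (-(a * ε / 2)) ^ n) := by
    intro n
    rw [← ENNReal.ofReal_toReal (measure_ne_top ν (A n))]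
    refine ENNReal.ofReal_le_ofReal ?_
    have h1 := measure_ge_le_exp_mul_mgf (μ := ν)
      (X := fun ζ => ∑ k ∈ Finset.range n, f (orbit s.toFun x ζ k)) (n * ε) ha.le ?_
    · refine h1.trans ?_
      have h2 := s.integral_exp_sum_le ℓ φ (B := B) (by simp [hB]) ha.le haB n x
      rw [mgf]
      calc _ ≤ Real.exp (-a * (n * ε)) *
            (Real.exp (2 * B * a) * Real.exp (4 * B ^ 2 * a ^ 2) ^ n) := by
            gcongr
        _ = Real.exp (2 * B * a) * Real.exp (n * (-(a * ε) + 4 * B ^ 2 * a ^ 2)) := by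
            rw [← Real.exp_nat_mul, ← Real.exp_add, ← Real.exp_add, ← Real.exp_add]
            ring_nf
        _ ≤ Real.exp (2 * B * a) * Real.exp (n * (-(a * ε / 2))) := by
            gcongr
            nlinarith
        _ = _ := by rw [← Real.exp_nat_mul]
    · refine .of_bound (Real.measurable_exp.comp
        ((s.measurable_sum_orbit f x n).const_mul a)).aestronglyMeasurable
        (Real.exp (a * (n * ‖f‖))) (.of_forall fun ζ => ?_)
      rw [Real.norm_of_nonneg (Real.exp_pos _).le]
      exact Real.exp_le_exp.2 (mul_le_mul_of_nonneg_left
        ((le_abs_self _).trans (s.abs_sum_orbit_le f x n ζ)) ha.le)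
  have hsum : ∑' n, ν (A n) ≠ ∞ := by
    refine ne_top_of_le_ne_top ?_ (ENNReal.tsum_le_tsum hbound)
    have : Summable fun n : ℕ => Real.exp (2 * B * a) * Real.exp (-(a * ε / 2)) ^ n :=
      (summable_geometric_of_lt_one (Real.exp_pos _).le
        (Real.exp_lt_one_iff.2 (by have := mul_pos ha hε; linarith))).mul_left _
    exact this.tsum_ofReal_ne_top
  filter_upwards [ae_eventually_notMem hsum] with ζ hζ
  filter_upwards [hζ] with n hn
  simpa [hA] using hn

/-- The strong law of large numbers for orbits started from a fixed point. -/
theorem ae_tendsto_average {f : C(K, ℝ)} (hf : Summable fun n => ‖(s.op ℓ ℝ)^[n] f‖) (x : K) :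
    ∀ᵐ ζ ∂(Measure.infinitePi fun _ : ℕ => ℓ),
      Tendsto (fun n : ℕ => (n : ℝ)⁻¹ * ∑ k ∈ Finset.range n, f (orbit s.toFun x ζ k))
        atTop (𝓝 0) := by
  obtain ⟨φ, rfl⟩ := s.exists_poisson ℓ hf
  have h1 := fun j : ℕ => s.ae_eventually_sum_lt ℓ φ x (Nat.one_div_pos_of_nat (α := ℝ) (n := j))
  -- Applying the one-sided bound to `-φ` gives the lower deviation.
  have h2 := fun j : ℕ =>
    s.ae_eventually_sum_lt ℓ (-φ) x (Nat.one_div_pos_of_nat (α := ℝ) (n := j))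
  filter_upwards [ae_all_iff.2 h1, ae_all_iff.2 h2] with ζ h1 h2
  rw [Metric.tendsto_nhds]
  intro ε hε
  obtain ⟨j, hj⟩ := exists_nat_one_div_lt hε
  filter_upwards [h1 j, h2 j, eventually_gt_atTop 0] with n hn1 hn2 hn
  have hn' : (0 : ℝ) < n := by exact_mod_cast hn
  have e : -φ - s.op ℓ ℝ (-φ) = -(φ - s.op ℓ ℝ φ) := by rw [map_neg]; abel
  rw [e] at hn2
  simp only [ContinuousMap.neg_apply, Finset.sum_neg_distrib] at hn2
  rw [Real.dist_eq, sub_zero, abs_mul, abs_of_pos (inv_pos.2 hn'), inv_mul_lt_iff₀ hn', abs_lt]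
  have := mul_lt_mul_of_pos_left hj hn'
  constructor <;> linarith

end RandomMap


/-! ### Central limit theorem by approximate eigenfunctions -/

/-- Second-order expansion of the twisted eigenvalue equation at a point. -/
lemma norm_twisted_expansion_le {f φ ψ β β' c B ε s : ℝ} (hfφ : f = φ - ψ) (hB : 1 ≤ B)
    (hf : |f| ≤ B) (hφ : |φ| ≤ B) (hψ : |ψ| ≤ B) (hβ : |β| ≤ B) (hβ' : |β'| ≤ B) (hc : |c| ≤ B)
    (hε : |f ^ 2 / 2 + f * ψ + β' - β - c| ≤ ε) (hs : |s| * B ≤ 1) :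
    ‖Complex.exp (s * f * Complex.I) * (1 + s * ψ * Complex.I - s ^ 2 * β') -
      (Real.exp (-(s ^ 2 * c)) : ℝ) * (1 + s * φ * Complex.I - s ^ 2 * β)‖ ≤
      s ^ 2 * ε + 20 * B ^ 4 * |s| ^ 3 := by
  have hs0 := abs_nonneg s
  have hs1 : |s| ≤ 1 := by nlinarith
  have hs2 : s ^ 2 = |s| ^ 2 := (sq_abs s).symm
  have hsf : |s| * |f| ≤ 1 := (mul_le_mul_of_nonneg_left hf hs0).trans hs
  set e₁ : ℂ := Complex.exp (s * f * Complex.I) -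
    (1 + s * f * Complex.I - s ^ 2 * f ^ 2 / 2) with he₁
  set e₂ : ℝ := Real.exp (-(s ^ 2 * c)) - (1 - s ^ 2 * c) with he₂
  have h1 : ‖e₁‖ ≤ |s| ^ 3 * B ^ 3 := by
    have hn : ‖(s * f * Complex.I : ℂ)‖ = |s| * |f| := by simp
    have h := Complex.exp_bound (x := s * f * Complex.I) (by rw [hn]; exact hsf)
      (n := 3) (by norm_num)
    have hsum : ∑ m ∈ Finset.range 3, (s * f * Complex.I : ℂ) ^ m / (m.factorial : ℂ) =
        1 + s * f * Complex.I - s ^ 2 * f ^ 2 / 2 := by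
      simp only [Finset.sum_range_succ, Finset.sum_range_zero, mul_pow, Complex.I_sq]
      simp [Nat.factorial]; ring
    rw [hsum, hn] at h
    refine h.trans ?_
    have h0 : (|s| * |f|) ^ 3 ≤ |s| ^ 3 * B ^ 3 := by rw [mul_pow]; gcongr
    have h2 : (0 : ℝ) ≤ (|s| * |f|) ^ 3 := by positivity
    norm_num [Nat.factorial]
    nlinarith
  have h2 : |e₂| ≤ |s| ^ 3 * B ^ 2 := by
    have hle : |s| ^ 2 * |c| ≤ 1 := by
      have : |s| * |c| ≤ 1 := (mul_le_mul_of_nonneg_left hc hs0).trans hs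
      have h0 : 0 ≤ |s| * |c| := by positivity
      nlinarith
    have hsc : |(-(s ^ 2 * c))| ≤ 1 := by
      rw [abs_neg, abs_mul, hs2, abs_of_nonneg (by positivity)]; exact hle
    have h := Real.abs_exp_sub_one_sub_id_le hsc
    have e : Real.exp (-(s ^ 2 * c)) - 1 - -(s ^ 2 * c) = e₂ := by rw [he₂]; ring
    rw [e] at h
    refine h.trans ?_
    have hc2 : c ^ 2 ≤ B ^ 2 := sq_le_sq' (abs_le.1 hc).1 (abs_le.1 hc).2
    have : |s| ^ 4 ≤ |s| ^ 3 := pow_le_pow_of_le_one hs0 hs1 (by norm_num)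
    calc (-(s ^ 2 * c)) ^ 2 = |s| ^ 4 * c ^ 2 := by rw [hs2]; ring
      _ ≤ |s| ^ 3 * B ^ 2 := by gcongr
  -- Terms are grouped by powers of `s`. Orders zero and one cancel because `f + ψ = φ`, and order
  -- two is the quantity bounded by `ε`.
  have hsplit : Complex.exp (s * f * Complex.I) * (1 + s * ψ * Complex.I - s ^ 2 * β') -
      (Real.exp (-(s ^ 2 * c)) : ℝ) * (1 + s * φ * Complex.I - s ^ 2 * β) =
      ((-(s ^ 2 * (f ^ 2 / 2 + f * ψ + β' - β - c)) : ℝ) : ℂ) +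
      ((s ^ 3 * (-(f * β') - f ^ 2 * ψ / 2 + c * φ) : ℝ) : ℂ) * Complex.I +
      ((s ^ 4 * (f ^ 2 * β' / 2 - c * β) : ℝ) : ℂ) +
      e₁ * (1 + s * ψ * Complex.I - s ^ 2 * β') -
      e₂ * (1 + s * φ * Complex.I - s ^ 2 * β) := by
    have x1 : Complex.exp (s * f * Complex.I) =
        e₁ + (1 + s * f * Complex.I - s ^ 2 * f ^ 2 / 2) := by rw [he₁]; ring
    have x2 : (Real.exp (-(s ^ 2 * c)) : ℝ) = e₂ + (1 - s ^ 2 * c) := by rw [he₂]; ring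
    rw [x1, x2, hfφ]
    push_cast
    linear_combination (s : ℂ) ^ 2 * ((φ : ℂ) - ψ) * ψ * Complex.I_sq
  have hlin : ∀ u v : ℝ, |u| ≤ B → |v| ≤ B → ‖(1 + s * u * Complex.I - s ^ 2 * v : ℂ)‖ ≤ 3 * B := by
    intro u v hu hv
    have a1 : ‖(s * u * Complex.I : ℂ)‖ ≤ B := by
      have : ‖(s * u * Complex.I : ℂ)‖ = |s| * |u| := by simp
      rw [this]
      exact (mul_le_of_le_one_left (abs_nonneg u) hs1).trans hu
    have a2 : ‖(s ^ 2 * v : ℂ)‖ ≤ B := by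
      have : ‖(s ^ 2 * v : ℂ)‖ = |s| ^ 2 * |v| := by simp
      rw [this]
      exact (mul_le_of_le_one_left (abs_nonneg v) (pow_le_one₀ hs0 hs1)).trans hv
    calc _ ≤ ‖(1 : ℂ)‖ + ‖(s * u * Complex.I : ℂ)‖ + ‖(s ^ 2 * v : ℂ)‖ :=
          (norm_sub_le _ _).trans (add_le_add (norm_add_le _ _) le_rfl)
      _ ≤ 3 * B := by rw [norm_one]; linarith
  have b1 : |(-(s ^ 2 * (f ^ 2 / 2 + f * ψ + β' - β - c)))| ≤ s ^ 2 * ε := by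
    rw [abs_neg, abs_mul, abs_of_nonneg (sq_nonneg s)]; gcongr
  have hfsq : |f| ^ 2 ≤ B ^ 2 := by gcongr
  have hB34 : B ^ 3 ≤ B ^ 4 := pow_le_pow_right₀ hB (by norm_num)
  have hB24 : B ^ 2 ≤ B ^ 4 := pow_le_pow_right₀ hB (by norm_num)
  have b2 : |s ^ 3 * (-(f * β') - f ^ 2 * ψ / 2 + c * φ)| ≤ |s| ^ 3 * (3 * B ^ 4) := by
    rw [abs_mul, abs_pow]
    gcongr
    have y1 : |f * β'| ≤ B * B := by rw [abs_mul]; gcongr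
    have y2 : |f ^ 2 * ψ / 2| ≤ B ^ 2 * B := by
      rw [abs_div, abs_mul, abs_pow, abs_two]
      have : |f| ^ 2 * |ψ| ≤ B ^ 2 * B := by gcongr
      have h0 : 0 ≤ |f| ^ 2 * |ψ| := by positivity
      linarith
    have y3 : |c * φ| ≤ B * B := by rw [abs_mul]; gcongr
    have := abs_add_le (-(f * β') - f ^ 2 * ψ / 2) (c * φ)
    have := abs_sub (-(f * β')) (f ^ 2 * ψ / 2)
    rw [abs_neg] at this
    nlinarith
  have b3 : |s ^ 4 * (f ^ 2 * β' / 2 - c * β)| ≤ |s| ^ 3 * (2 * B ^ 4) := by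
    rw [abs_mul, abs_pow]
    have : |s| ^ 4 ≤ |s| ^ 3 := pow_le_pow_of_le_one hs0 hs1 (by norm_num)
    gcongr
    have y2 : |f ^ 2 * β' / 2| ≤ B ^ 2 * B := by
      rw [abs_div, abs_mul, abs_pow, abs_two]
      have : |f| ^ 2 * |β'| ≤ B ^ 2 * B := by gcongr
      have h0 : 0 ≤ |f| ^ 2 * |β'| := by positivity
      linarith
    have y3 : |c * β| ≤ B * B := by rw [abs_mul]; gcongr
    have := abs_sub (f ^ 2 * β' / 2) (c * β)
    nlinarith
  have b4 : ‖e₁ * (1 + s * ψ * Complex.I - s ^ 2 * β')‖ ≤ |s| ^ 3 * (3 * B ^ 4) := by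
    rw [norm_mul]
    calc _ ≤ |s| ^ 3 * B ^ 3 * (3 * B) := by gcongr; exact hlin _ _ hψ hβ'
      _ = _ := by ring
  have b5 : ‖e₂ * (1 + s * φ * Complex.I - s ^ 2 * β)‖ ≤ |s| ^ 3 * (3 * B ^ 4) := by
    rw [norm_mul, Complex.norm_real, Real.norm_eq_abs]
    calc _ ≤ |s| ^ 3 * B ^ 2 * (3 * B) := by gcongr; exact hlin _ _ hφ hβ
      _ = |s| ^ 3 * (3 * B ^ 3) := by ring
      _ ≤ _ := by gcongr
  rw [hsplit]
  refine (norm_sub_le _ _).trans ?_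
  refine (add_le_add ((norm_add_le _ _).trans (add_le_add ((norm_add_le _ _).trans
    (add_le_add (norm_add_le _ _) le_rfl)) le_rfl)) le_rfl).trans ?_
  rw [norm_mul, Complex.norm_I, mul_one, Complex.norm_real, Complex.norm_real, Complex.norm_real,
    Real.norm_eq_abs, Real.norm_eq_abs, Real.norm_eq_abs]
  have h0 : 0 ≤ |s| ^ 3 * B ^ 4 := by positivity
  linarith

namespace RandomMap

variable {K Z : Type*} [MetricSpace K] [CompactSpace K] [MeasurableSpace K] [BorelSpace K]
  [MeasurableSpace Z] (s : RandomMap K Z) (ℓ : Measure Z) [IsProbabilityMeasure ℓ]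

lemma norm_iterate_mul_op_sub_le {w : C(K, ℂ)} (hw : ‖w‖ ≤ 1) (h h' : C(K, ℂ)) (n : ℕ) :
    ‖(fun g => w * s.op ℓ ℂ g)^[n] h - (fun g => w * s.op ℓ ℂ g)^[n] h'‖ ≤ ‖h - h'‖ := by
  induction n with
  | zero => exact le_rfl
  | succ n ih =>
    rw [Function.iterate_succ_apply', Function.iterate_succ_apply', ← mul_sub, ← map_sub]
    exact (norm_mul_le _ _).trans ((mul_le_of_le_one_left (norm_nonneg _) hw).trans
      ((s.norm_op_le ℓ _).trans ih))

/-- Stability of approximate eigenfunctions of weighted Markov operators. -/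
lemma norm_iterate_mul_op_one_sub_le {w : C(K, ℂ)} (hw : ‖w‖ ≤ 1) {a : ℂ} (ha : ‖a‖ ≤ 1)
    (v : C(K, ℂ)) (n : ℕ) :
    ‖(fun g => w * s.op ℓ ℂ g)^[n] 1 - a ^ n • (1 : C(K, ℂ))‖ ≤
      2 * ‖v - 1‖ + n * ‖w * s.op ℓ ℂ v - a • v‖ := by
  -- Telescoping: the weighted operator and multiplication by `a` both have norm at most one, so the
  -- one-step errors only add up.
  have key : ‖(fun g => w * s.op ℓ ℂ g)^[n] v - a ^ n • v‖ ≤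
      n * ‖w * s.op ℓ ℂ v - a • v‖ := by
    induction n with
    | zero => simp
    | succ n ih =>
      have h1 := s.norm_iterate_mul_op_sub_le ℓ hw (w * s.op ℓ ℂ v) (a • v) n
      have h2 : (fun g => w * s.op ℓ ℂ g)^[n] (a • v) =
          a • (fun g => w * s.op ℓ ℂ g)^[n] v := by
        clear ih h1
        induction n with
        | zero => rfl
        | succ n ih => rw [Function.iterate_succ_apply', Function.iterate_succ_apply', ih, map_smul,
            mul_smul_comm]
      rw [h2] at h1
      rw [Function.iterate_succ_apply]
      have h3 : ‖a • ((fun g => w * s.op ℓ ℂ g)^[n] v - a ^ n • v)‖ ≤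
          n * ‖w * s.op ℓ ℂ v - a • v‖ := by
        rw [norm_smul]
        exact (mul_le_of_le_one_left (norm_nonneg _) ha).trans ih
      have h4 : (fun g => w * s.op ℓ ℂ g)^[n] (w * s.op ℓ ℂ v) - a ^ (n + 1) • v =
          ((fun g => w * s.op ℓ ℂ g)^[n] (w * s.op ℓ ℂ v) -
            a • (fun g => w * s.op ℓ ℂ g)^[n] v) +
          a • ((fun g => w * s.op ℓ ℂ g)^[n] v - a ^ n • v) := by
        rw [smul_sub, smul_smul, ← pow_succ', sub_add_sub_cancel]
      rw [h4]
      refine (norm_add_le _ _).trans ?_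
      push_cast
      linarith
  have h5 := s.norm_iterate_mul_op_sub_le ℓ hw 1 v n
  have h6 : ‖a ^ n • (v - 1)‖ ≤ ‖v - 1‖ := by
    rw [norm_smul, norm_pow]
    exact mul_le_of_le_one_left (norm_nonneg _) (pow_le_one₀ (norm_nonneg _) ha)
  rw [norm_sub_rev (1 : C(K, ℂ)) v] at h5
  have h7 : (fun g => w * s.op ℓ ℂ g)^[n] 1 - a ^ n • (1 : C(K, ℂ)) =
      ((fun g => w * s.op ℓ ℂ g)^[n] 1 - (fun g => w * s.op ℓ ℂ g)^[n] v) +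
      ((fun g => w * s.op ℓ ℂ g)^[n] v - a ^ n • v) + a ^ n • (v - 1) := by
    rw [smul_sub]; abel
  rw [h7]
  refine (norm_add_le _ _).trans ((add_le_add (norm_add_le _ _) le_rfl).trans ?_)
  linarith

/-- The weight `x ↦ exp (i a f x)`. -/
noncomputable def phase (f : C(K, ℝ)) (a : ℝ) : C(K, ℂ) :=
  ⟨fun x => Complex.exp (a * f x * Complex.I), by fun_prop⟩

omit [MeasurableSpace K] [BorelSpace K] in
lemma norm_phase_le (f : C(K, ℝ)) (a : ℝ) : ‖phase f a‖ ≤ 1 := by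
  refine (ContinuousMap.norm_le _ zero_le_one).2 fun x => ?_
  change ‖Complex.exp (a * f x * Complex.I)‖ ≤ 1
  rw [← Complex.ofReal_mul, Complex.norm_exp_ofReal_mul_I]

/-- Convergence of the characteristic functions in the central limit theorem, at the operator
level. -/
lemma tendsto_iterate_phase_mul_op {φ : C(K, ℝ)} {c : ℝ} (hc : 0 ≤ c)
    (hb : ∀ ε > 0, ∃ b : C(K, ℝ), ∀ x,
      |(φ x - s.op ℓ ℝ φ x) ^ 2 / 2 + (φ x - s.op ℓ ℝ φ x) * s.op ℓ ℝ φ x +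
        s.op ℓ ℝ b x - b x - c| ≤ ε) (t : ℝ) :
    Tendsto (fun n : ℕ => (fun g => phase (φ - s.op ℓ ℝ φ) (t / √n) * s.op ℓ ℂ g)^[n] 1)
      atTop (𝓝 ((Real.exp (-(t ^ 2 * c)) : ℂ) • (1 : C(K, ℂ)))) := by
  rw [Metric.tendsto_nhds]
  intro η hη
  -- Over `n` steps the second-order error accumulates to `n u² ε = t² ε`, kept below `η / 2`.
  obtain ⟨b, hb⟩ := hb (η / (2 * (t ^ 2 + 1))) (by positivity)
  set ε := η / (2 * (t ^ 2 + 1)) with hε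
  have hε' : t ^ 2 * ε ≤ η / 2 := by
    rw [hε, ← mul_div_assoc, div_le_div_iff₀ (by positivity) (by positivity)]
    nlinarith [sq_nonneg t]
  set B := 1 + 2 * ‖φ‖ + ‖b‖ + c with hB
  have hφ0 := norm_nonneg φ
  have hb0 := norm_nonneg b
  have hB1 : 1 ≤ B := by rw [hB]; linarith
  have hφB : ∀ x, |φ x| ≤ ‖φ‖ := φ.norm_coe_le_norm
  have hψB : ∀ x, |s.op ℓ ℝ φ x| ≤ ‖φ‖ := fun x =>
    ((s.op ℓ ℝ φ).norm_coe_le_norm x).trans (s.norm_op_le ℓ φ)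
  have hbB : ∀ x, |b x| ≤ ‖b‖ := b.norm_coe_le_norm
  have hb'B : ∀ x, |s.op ℓ ℝ b x| ≤ ‖b‖ := fun x =>
    ((s.op ℓ ℝ b).norm_coe_le_norm x).trans (s.norm_op_le ℓ b)
  have hlim : Tendsto (fun n : ℕ => |t / √n|) atTop (𝓝 0) := by
    rw [← abs_zero]
    refine Tendsto.abs (Tendsto.div_atTop tendsto_const_nhds ?_)
    exact Real.tendsto_sqrt_atTop.comp tendsto_natCast_atTop_atTop
  have hev1 : ∀ᶠ n : ℕ in atTop, |t / √n| * B < 1 := by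
    have := hlim.mul_const B
    rw [zero_mul] at this
    exact this.eventually (eventually_lt_nhds one_pos)
  have hev2 : ∀ᶠ n : ℕ in atTop, |t / √n| * (4 * B + 20 * B ^ 4 * t ^ 2) < η / 2 := by
    have := hlim.mul_const (4 * B + 20 * B ^ 4 * t ^ 2)
    rw [zero_mul] at this
    exact this.eventually (eventually_lt_nhds (by positivity))
  filter_upwards [hev1, hev2, eventually_gt_atTop 0] with n hn1 hn2 hn
  have hn' : (0 : ℝ) < n := by exact_mod_cast hn
  have hns : n * (t / √n) ^ 2 = t ^ 2 := by
    rw [div_pow, Real.sq_sqrt hn'.le]; field_simp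
  set u := t / √n with hu
  have hu0 := abs_nonneg u
  have hu1 : |u| ≤ 1 := by nlinarith
  -- Second-order ansatz for the eigenfunction: `φ` removes the term of order `u`, and `b` makes the
  -- coefficient of `u²` nearly constant.
  set v : C(K, ℂ) := 1 + ((u : ℂ) * Complex.I) • toComplex φ - ((u : ℂ) ^ 2) • toComplex b with hv
  set a : ℂ := ((Real.exp (-(u ^ 2 * c)) : ℝ) : ℂ) with ha
  have ha1 : ‖a‖ ≤ 1 := by
    rw [ha, Complex.norm_real, Real.norm_of_nonneg (Real.exp_pos _).le, Real.exp_le_one_iff]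
    have : 0 ≤ u ^ 2 * c := by positivity
    linarith
  have han : a ^ n = (Real.exp (-(t ^ 2 * c)) : ℂ) := by
    rw [ha, ← Complex.ofReal_pow, ← Real.exp_nat_mul, ← hns]
    congr 2; ring
  have hone : s.op ℓ ℂ 1 = 1 := s.op_const ℓ (1 : ℂ)
  have hTv : s.op ℓ ℂ v = 1 + ((u : ℂ) * Complex.I) • toComplex (s.op ℓ ℝ φ) -
      ((u : ℂ) ^ 2) • toComplex (s.op ℓ ℝ b) := by
    rw [hv, map_sub, map_add, map_smul, map_smul, op_toComplex, op_toComplex, hone]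
  have hv1 : ‖v - 1‖ ≤ 2 * |u| * B := by
    refine (ContinuousMap.norm_le _ (by positivity)).2 fun x => ?_
    have e : (v - 1) x = (u * Complex.I) * (φ x : ℂ) - u ^ 2 * (b x : ℂ) := by
      simp only [hv, ContinuousMap.sub_apply, ContinuousMap.add_apply, ContinuousMap.one_apply,
        ContinuousMap.smul_apply, toComplex_apply, smul_eq_mul]
      ring
    have e1 : ‖(u * Complex.I) * (φ x : ℂ)‖ = |u| * |φ x| := by simp
    have e2 : ‖u ^ 2 * (b x : ℂ)‖ = |u| ^ 2 * |b x| := by simp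
    rw [e]
    refine (norm_sub_le _ _).trans ?_
    rw [e1, e2]
    have h1 : |u| * |φ x| ≤ |u| * B := by gcongr; linarith [hφB x]
    have h2 : |u| ^ 2 * |b x| ≤ |u| * B := by
      have : |u| ^ 2 ≤ |u| := by nlinarith
      gcongr
      linarith [hbB x]
    linarith
  have hstep : ‖phase (φ - s.op ℓ ℝ φ) u * s.op ℓ ℂ v - a • v‖ ≤
      u ^ 2 * ε + 20 * B ^ 4 * |u| ^ 3 := by
    refine (ContinuousMap.norm_le _ (by positivity)).2 fun x => ?_
    have h := norm_twisted_expansion_le (f := φ x - s.op ℓ ℝ φ x) (φ := φ x) (ψ := s.op ℓ ℝ φ x)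
      (β := b x) (β' := s.op ℓ ℝ b x) (c := c) (B := B) (ε := ε) (s := u) rfl hB1
      ((abs_sub _ _).trans (by linarith [hφB x, hψB x])) (by linarith [hφB x])
      (by linarith [hψB x]) (by linarith [hbB x]) (by linarith [hb'B x])
      (by rw [abs_of_nonneg hc]; linarith) (hb x) hn1.le
    refine (le_of_eq ?_).trans h
    congr 1
    rw [hTv]
    simp only [hv, phase, ContinuousMap.sub_apply, ContinuousMap.add_apply,
      ContinuousMap.one_apply, ContinuousMap.mul_apply, ContinuousMap.coe_mk,
      ContinuousMap.smul_apply, toComplex_apply, smul_eq_mul, ← ha]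
    push_cast
    ring
  have hmain := s.norm_iterate_mul_op_one_sub_le ℓ (norm_phase_le (φ - s.op ℓ ℝ φ) u) ha1 v n
  rw [han] at hmain
  rw [dist_eq_norm]
  refine hmain.trans_lt ?_
  have h3 : n * ‖phase (φ - s.op ℓ ℝ φ) u * s.op ℓ ℂ v - a • v‖ ≤
      t ^ 2 * ε + 20 * B ^ 4 * t ^ 2 * |u| := by
    calc _ ≤ n * (u ^ 2 * ε + 20 * B ^ 4 * |u| ^ 3) := by gcongr
      _ = (n * u ^ 2) * ε + 20 * B ^ 4 * (n * u ^ 2) * |u| := by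
        rw [← sq_abs u]; ring
      _ = _ := by rw [hns]
  linarith

/-- Convergence of characteristic functions in the central limit theorem for orbits. -/
theorem exists_tendsto_integral_exp [Nonempty K] {f : C(K, ℝ)}
    (hf : Summable fun n => ‖(s.op ℓ ℝ)^[n] f‖)
    (hmix : ∀ q : C(K, ℝ), ∃ c, Tendsto (fun n => (s.op ℓ ℝ)^[n] q) atTop
      (𝓝 (ContinuousMap.const K c))) :
    ∃ σ : ℝ≥0, ∀ (x : K) (t : ℝ), Tendsto (fun n : ℕ => ∫ ζ, Complex.exp
        (t * ((√n)⁻¹ * ∑ k ∈ Finset.range n, f (orbit s.toFun x ζ k) : ℝ) * Complex.I)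
        ∂(Measure.infinitePi fun _ : ℕ => ℓ)) atTop
      (𝓝 (Real.exp (-(σ ^ 2 * t ^ 2 / 2)) : ℂ)) := by
  obtain ⟨φ, rfl⟩ := s.exists_poisson ℓ hf
  -- Half the conditional variance of the martingale increment `φ (x_{k+1}) - T φ (x_k)`; its
  -- limiting mean `c` is half the asymptotic variance.
  set p : C(K, ℝ) := (1 / 2 : ℝ) • (s.op ℓ ℝ (φ ^ 2) - (s.op ℓ ℝ φ) ^ 2) with hp
  have hp0 : ∀ x, 0 ≤ p x := fun x => by
    have := s.sq_op_le_op_sq ℓ φ x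
    simp only [hp, ContinuousMap.smul_apply, ContinuousMap.sub_apply, ContinuousMap.pow_apply,
      smul_eq_mul]
    linarith
  obtain ⟨c, hpc⟩ := hmix p
  have hc : 0 ≤ c := by
    obtain ⟨x⟩ := ‹Nonempty K›
    refine ge_of_tendsto' (((continuous_eval_const (F := C(K, _)) x).tendsto _).comp hpc) fun n => ?_
    exact s.op_iterate_nonneg ℓ hp0 n x
  have hb : ∀ ε > 0, ∃ b : C(K, ℝ), ∀ x,
      |(φ x - s.op ℓ ℝ φ x) ^ 2 / 2 + (φ x - s.op ℓ ℝ φ x) * s.op ℓ ℝ φ x +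
        s.op ℓ ℝ b x - b x - c| ≤ ε := fun ε hε => by
    obtain ⟨b, hb⟩ := s.exists_approx_poisson ℓ hpc hε
    -- Since `f²/2 + f T φ = (φ² - (T φ)²)/2`, adding `φ²/2` to `b` turns this expression into `p`.
    refine ⟨b + (1 / 2 : ℝ) • φ ^ 2, fun x => ?_⟩
    refine le_trans (le_of_eq ?_) (((p - ContinuousMap.const K c - (b - s.op ℓ ℝ b)).norm_coe_le_norm
      x).trans hb)
    rw [Real.norm_eq_abs, map_add, map_smul]
    simp only [hp, ContinuousMap.smul_apply, ContinuousMap.sub_apply, ContinuousMap.pow_apply,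
      smul_eq_mul, ContinuousMap.add_apply, ContinuousMap.const_apply]
    congr 1; ring
  refine ⟨⟨√(2 * c), Real.sqrt_nonneg _⟩, fun x t => ?_⟩
  have h := ((continuous_eval_const (F := C(K, _)) x).tendsto _).comp
    (s.tendsto_iterate_phase_mul_op ℓ hc hb t)
  have e : ((Real.exp (-(t ^ 2 * c)) : ℂ) • (1 : C(K, ℂ))) x =
      (Real.exp (-((⟨√(2 * c), Real.sqrt_nonneg _⟩ : ℝ≥0) ^ 2 * t ^ 2 / 2)) : ℂ) := by
    rw [ContinuousMap.smul_apply, ContinuousMap.one_apply, smul_eq_mul, mul_one]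
    congr 3
    change _ = √(2 * c) ^ 2 * t ^ 2 / 2
    rw [Real.sq_sqrt (by positivity)]; ring
  rw [e] at h
  refine h.congr fun n => ?_
  rw [Function.comp_apply, ← integral_prod_mul]
  refine integral_congr_ae (.of_forall fun ζ => ?_)
  simp only [ContinuousMap.one_apply, mul_one, phase, ContinuousMap.coe_mk]
  rw [← Complex.exp_sum]
  congr 1
  push_cast
  rw [Finset.mul_sum, Finset.mul_sum, Finset.sum_mul]
  refine Finset.sum_congr rfl fun k _ => ?_
  ring

end RandomMap


/-! ### Convergence of the iterates to constants -/

namespace RandomMap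

variable {K Z : Type*} [MetricSpace K] [CompactSpace K] [MeasurableSpace K] [BorelSpace K]
  [MeasurableSpace Z] (s : RandomMap K Z) (ℓ : Measure Z) [IsProbabilityMeasure ℓ]

/-- Exponential decay of oscillations gives exponential convergence to a constant. -/
lemma exists_norm_op_iterate_sub_const_le [Nonempty K] {h : C(K, ℝ)} {M q : ℝ} (hq0 : 0 ≤ q)
    (hq1 : q < 1)
    (hosc : ∀ n x x', |(s.op ℓ ℝ)^[n] h x - (s.op ℓ ℝ)^[n] h x'| ≤ M * q ^ n) :
    ∃ c, ∀ n, ‖(s.op ℓ ℝ)^[n] h - ContinuousMap.const K c‖ ≤ M * q ^ n := by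
  obtain ⟨x₀⟩ := ‹Nonempty K›
  have hM : 0 ≤ M := by simpa using (abs_nonneg _).trans (hosc 0 x₀ x₀)
  -- `T` fixes constants and contracts the sup norm, so later iterates stay within the oscillation
  -- of the `n`-th one.
  have key : ∀ n k x y, |(s.op ℓ ℝ)^[k + n] h y - (s.op ℓ ℝ)^[n] h x| ≤ M * q ^ n := by
    intro n k x y
    have h1 : ‖(s.op ℓ ℝ)^[n] h - ContinuousMap.const K ((s.op ℓ ℝ)^[n] h x)‖ ≤ M * q ^ n :=
      (ContinuousMap.norm_le _ (by positivity)).2 fun y => hosc n y x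
    have h2 := (s.norm_op_iterate_le ℓ _ k).trans h1
    rw [op_iterate_sub, op_iterate_const, ← Function.iterate_add_apply] at h2
    exact (ContinuousMap.norm_coe_le_norm _ y).trans h2
  have hcauchy : CauchySeq fun n => (s.op ℓ ℝ)^[n] h x₀ :=
    cauchySeq_of_le_geometric q M hq1 fun n => by
      rw [dist_comm, Real.dist_eq, add_comm]
      exact key n 1 x₀ x₀
  obtain ⟨c, hc⟩ := cauchySeq_tendsto_of_complete hcauchy
  refine ⟨c, fun n => (ContinuousMap.norm_le _ (by positivity)).2 fun x => ?_⟩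
  have h3 : Tendsto (fun k => |(s.op ℓ ℝ)^[k + n] h x₀ - (s.op ℓ ℝ)^[n] h x|) atTop
      (𝓝 |c - (s.op ℓ ℝ)^[n] h x|) :=
    (((tendsto_add_atTop_iff_nat n).2 hc).sub_const _).abs
  rw [ContinuousMap.sub_apply, ContinuousMap.const_apply, norm_sub_rev]
  exact le_of_tendsto' h3 fun k => key n k x x₀

-- Stone–Weierstrass: Lipschitz functions on a compact space form a subalgebra, and distances to
-- points separate points.
omit [MeasurableSpace K] [BorelSpace K] in
lemma exists_lipschitz_norm_sub_lt (h : C(K, ℝ)) {ε : ℝ} (hε : 0 < ε) :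
    ∃ g : C(K, ℝ), (∃ L, LipschitzWith L g) ∧ ‖g - h‖ < ε := by
  let A : Subalgebra ℝ C(K, ℝ) :=
    { carrier := {g | ∃ L, LipschitzWith L g}
      mul_mem' := by
        rintro g g' ⟨L, hL⟩ ⟨L', hL'⟩
        refine ⟨‖g‖₊ * L' + ‖g'‖₊ * L, LipschitzWith.of_dist_le_mul fun x y => ?_⟩
        have h1 := hL.dist_le_mul x y
        have h2 := hL'.dist_le_mul x y
        have h3 := g.norm_coe_le_norm x
        have h4 := g'.norm_coe_le_norm y
        rw [Real.dist_eq] at h1 h2 ⊢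
        rw [Real.norm_eq_abs] at h3 h4
        have e : (g * g') x - (g * g') y = g x * (g' x - g' y) + g' y * (g x - g y) := by
          simp only [ContinuousMap.mul_apply]; ring
        rw [e]
        refine (abs_add_le _ _).trans ?_
        rw [abs_mul, abs_mul]
        push_cast
        calc _ ≤ ‖g‖ * (L' * dist x y) + ‖g'‖ * (L * dist x y) := by gcongr
          _ = _ := by ring
      add_mem' := by
        rintro g g' ⟨L, hL⟩ ⟨L', hL'⟩
        exact ⟨L + L', hL.add hL'⟩
      algebraMap_mem' := fun r => ⟨0, LipschitzWith.const r⟩ }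
  have hA : A.SeparatesPoints := by
    intro x y hxy
    refine ⟨fun z => dist z y, ⟨⟨fun z => dist z y, by fun_prop⟩, ⟨1, LipschitzWith.dist_left y⟩,
      rfl⟩, ?_⟩
    simpa using hxy
  obtain ⟨g, hg⟩ :=
    ContinuousMap.exists_mem_subalgebra_near_continuousMap_of_separatesPoints A hA h ε hε
  exact ⟨g, g.2, hg⟩

/-- Density of Lipschitz functions plus contractivity of `T`. This is needed for the conditional
variance in the central limit theorem, which is only known to be continuous. -/
lemma exists_tendsto_op_iterate_const [Nonempty K]
    (hlip : ∀ h : C(K, ℝ), (∃ L, LipschitzWith L h) →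
      ∃ c, Tendsto (fun n => (s.op ℓ ℝ)^[n] h) atTop (𝓝 (ContinuousMap.const K c)))
    (h : C(K, ℝ)) :
    ∃ c, Tendsto (fun n => (s.op ℓ ℝ)^[n] h) atTop (𝓝 (ContinuousMap.const K c)) := by
  have key : ∀ ε > 0, ∃ c, ∀ᶠ n in atTop,
      dist ((s.op ℓ ℝ)^[n] h) (ContinuousMap.const K c) < ε := by
    intro ε hε
    obtain ⟨g, hg, hgh⟩ := exists_lipschitz_norm_sub_lt h (half_pos hε)
    obtain ⟨c, hc⟩ := hlip g hg
    refine ⟨c, ?_⟩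
    filter_upwards [Metric.tendsto_nhds.1 hc _ (half_pos hε)] with n hn
    have h1 : dist ((s.op ℓ ℝ)^[n] h) ((s.op ℓ ℝ)^[n] g) ≤ ‖g - h‖ := by
      rw [dist_comm, dist_eq_norm, ← op_iterate_sub]
      exact s.norm_op_iterate_le ℓ _ n
    linarith [dist_triangle ((s.op ℓ ℝ)^[n] h) ((s.op ℓ ℝ)^[n] g) (ContinuousMap.const K c)]
  have hcauchy : CauchySeq fun n => (s.op ℓ ℝ)^[n] h := by
    rw [Metric.cauchySeq_iff']
    intro ε hε
    obtain ⟨c, hc⟩ := key (ε / 2) (half_pos hε)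
    obtain ⟨N, hN⟩ := eventually_atTop.1 hc
    refine ⟨N, fun n hn => ?_⟩
    linarith [dist_triangle_right ((s.op ℓ ℝ)^[n] h) ((s.op ℓ ℝ)^[N] h) (ContinuousMap.const K c),
      hN n hn, hN N le_rfl]
  obtain ⟨g, hg⟩ := cauchySeq_tendsto_of_complete hcauchy
  obtain ⟨x₀⟩ := ‹Nonempty K›
  have : g = ContinuousMap.const K (g x₀) := by
    ext x
    refine eq_of_forall_dist_le fun ε hε => ?_
    obtain ⟨c, hc⟩ := key (ε / 2) (half_pos hε)
    have h1 : dist g (ContinuousMap.const K c) ≤ ε / 2 :=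
      le_of_tendsto (hg.dist tendsto_const_nhds) (hc.mono fun n hn => hn.le)
    have h2 := (ContinuousMap.dist_apply_le_dist (f := g) (g := ContinuousMap.const K c) x).trans h1
    have h3 := (ContinuousMap.dist_apply_le_dist (f := g) (g := ContinuousMap.const K c) x₀).trans h1
    simp only [ContinuousMap.const_apply] at h2 h3 ⊢
    linarith [dist_triangle_right (g x) (g x₀) c]
  exact ⟨g x₀, this ▸ hg⟩

end RandomMap

/-! ### Restriction to a compact invariant set -/

section Restrict

variable {X Z : Type*} [MetricSpace X] [MeasurableSpace X]
  [MeasurableSpace Z] {S : X × Z → X} {E : Set Z} {K : Set X}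

open Classical in
/-- The restriction of a random dynamical system to an invariant set. -/
noncomputable def restrict (hS : Measurable S) (hS' : ∀ z, Continuous fun x => S (x, z))
    (hE : MeasurableSet E) (hK : ∀ x ∈ K, ∀ z ∈ E, S (x, z) ∈ K) : RandomMap K Z where
  -- Inputs outside `E` act as the identity, which keeps `K` invariant; this is harmless once `E`
  -- has full measure.
  toFun p := ⟨if p.2 ∈ E then S (p.1, p.2) else p.1, by
    split_ifs with h
    exacts [hK _ p.1.2 _ h, p.1.2]⟩
  measurable := by
    refine Measurable.subtype_mk (Measurable.ite (measurable_snd hE) ?_ ?_)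
    · exact hS.comp ((measurable_subtype_coe.comp measurable_fst).prodMk measurable_snd)
    · exact measurable_subtype_coe.comp measurable_fst
  continuous_left z := by
    refine Continuous.subtype_mk ?_ _
    by_cases h : z ∈ E
    · simpa only [h, if_true, Function.comp_def] using
        (hS' z).comp (continuous_subtype_val (p := (· ∈ K)))
    · simpa only [h, if_false] using continuous_subtype_val

variable (hS : Measurable S) (hS' : ∀ z, Continuous fun x => S (x, z))
    (hE : MeasurableSet E) (hK : ∀ x ∈ K, ∀ z ∈ E, S (x, z) ∈ K)

lemma coe_orbit_restrict {ζ : ℕ → Z} (hζ : ∀ i, ζ i ∈ E) (x : K) (n : ℕ) :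
    ((orbit (restrict hS hS' hE hK).toFun x ζ n : K) : X) = orbit S x ζ n := by
  induction n with
  | zero => rfl
  | succ n ih => rw [orbit, orbit, ← ih]; simp [restrict, hζ]

variable {ℓ : Measure Z} [IsProbabilityMeasure ℓ]

lemma op_restrict_iterate [BorelSpace X] [CompactSpace K] (hEℓ : ∀ᵐ z ∂ℓ, z ∈ E) {F : X → ℝ}
    (hF : BddMeasurable F) {h : C(K, ℝ)} (hFh : ∀ x : K, F x = h x) (n : ℕ) (x : K) :
    ((restrict hS hS' hE hK).op ℓ ℝ)^[n] h x = (markovOp S ℓ)^[n] F x := by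
  rw [RandomMap.coe_op_iterate, ← integral_orbit hS ℓ hF,
    ← integral_orbit (restrict hS hS' hE hK).measurable ℓ h.bddMeasurable]
  refine integral_congr_ae ?_
  filter_upwards [ae_forall_mem_infinitePi hEℓ] with ζ hζ
  rw [← coe_orbit_restrict hS hS' hE hK hζ, hFh]

/-- Lipschitz observables converge exponentially on a compact invariant set with exponential
decay of oscillations. -/
lemma exists_norm_restrict_op_iterate_sub_const_le [BorelSpace X] [CompactSpace K] [Nonempty K]
    (hEℓ : ∀ᵐ z ∂ℓ, z ∈ E) {C q : ℝ} (hC : 0 ≤ C) (hq0 : 0 < q) (hq1 : q < 1)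
    (hdecay : ∀ (f : X → ℝ) (A : ℝ), Measurable f → (∀ x, |f x| ≤ A) →
      (∀ x ∈ K, ∀ x' ∈ K, |f x - f x'| ≤ A * dist x x') → ∀ n, ∀ x ∈ K, ∀ x' ∈ K,
        |(markovOp S ℓ)^[n] f x - (markovOp S ℓ)^[n] f x'| ≤ A * (C * q ^ n))
    {h : C(K, ℝ)} (hL : ∃ L, LipschitzWith L h) :
    ∃ M c, 0 ≤ M ∧ ∀ n, ‖((restrict hS hS' hE hK).op ℓ ℝ)^[n] h - ContinuousMap.const K c‖ ≤
      M * q ^ n := by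
  obtain ⟨L, hL⟩ := hL
  have hKm : MeasurableSet K := (isCompact_iff_compactSpace.2 ‹_›).measurableSet
  -- Extension by zero is enough: the decay hypothesis asks for the Lipschitz bound on `K` only.
  set F : X → ℝ := Function.extend Subtype.val h 0 with hF
  have hFh : ∀ x : K, F x = h x := fun x => Subtype.val_injective.extend_apply _ _ _
  set A := max ‖h‖ L with hA
  have hA0 : 0 ≤ A := le_max_of_le_left (norm_nonneg _)
  have hFm : Measurable F :=
    (MeasurableEmbedding.subtype_coe hKm).measurable_extend h.continuous.measurable measurable_const
  have hFA : ∀ x, |F x| ≤ A := fun x => by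
    by_cases hx : x ∈ K
    · rw [hFh ⟨x, hx⟩]; exact (h.norm_coe_le_norm _).trans (le_max_left _ _)
    · rw [hF, Function.extend_apply' _ _ _ (by rintro ⟨y, rfl⟩; exact hx y.2)]
      simpa using hA0
  have hFL : ∀ x ∈ K, ∀ x' ∈ K, |F x - F x'| ≤ A * dist x x' := fun x hx x' hx' => by
    rw [hFh ⟨x, hx⟩, hFh ⟨x', hx'⟩]
    exact (hL.dist_le_mul ⟨x, hx⟩ ⟨x', hx'⟩).trans
      (mul_le_mul_of_nonneg_right (le_max_right _ _) dist_nonneg)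
  obtain ⟨c, hc⟩ := (restrict hS hS' hE hK).exists_norm_op_iterate_sub_const_le ℓ (h := h)
    (M := A * C) hq0.le hq1 fun n x x' => by
      rw [op_restrict_iterate hS hS' hE hK hEℓ ⟨hFm, A, hFA⟩ hFh,
        op_restrict_iterate hS hS' hE hK hEℓ ⟨hFm, A, hFA⟩ hFh, mul_assoc]
      exact hdecay F A hFm hFA hFL n x x.2 x' x'.2
  exact ⟨A * C, c, by positivity, hc⟩

/-- Limit theorems on a compact invariant set with exponential decay of oscillations. -/
theorem limit_theorems_of_exp_decay_osc [BorelSpace X] (hKc : IsCompact K)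
    (hS : Measurable S) (hS' : ∀ z, Continuous fun x => S (x, z))
    (hE : MeasurableSet E) (hK : ∀ x ∈ K, ∀ z ∈ E, S (x, z) ∈ K)
    (hEℓ : ∀ᵐ z ∂ℓ, z ∈ E) {C q : ℝ} (hC : 0 ≤ C) (hq0 : 0 < q) (hq1 : q < 1)
    (hdecay : ∀ (f : X → ℝ) (A : ℝ), Measurable f → (∀ x, |f x| ≤ A) →
      (∀ x ∈ K, ∀ x' ∈ K, |f x - f x'| ≤ A * dist x x') → ∀ n, ∀ x ∈ K, ∀ x' ∈ K,
        |(markovOp S ℓ)^[n] f x - (markovOp S ℓ)^[n] f x'| ≤ A * (C * q ^ n))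
    (hK0 : K.Nonempty) {f : X → ℝ} (hfL : ∃ L, LipschitzWith L f) (hfC : ∃ C, ∀ x, |f x| ≤ C) :
    ∃ c : ℝ, ∃ σ : ℝ≥0, ∀ x ∈ K,
      Tendsto (fun n => (markovOp S ℓ)^[n] f x) atTop (𝓝 c) ∧
      (∀ᵐ ζ ∂(Measure.infinitePi fun _ : ℕ => ℓ),
        Tendsto (fun n : ℕ => (n : ℝ)⁻¹ * ∑ k ∈ Finset.range n, (f (orbit S x ζ k) - c))
          atTop (𝓝 0)) ∧
      ∀ t : ℝ, Tendsto (fun n : ℕ => ∫ ζ, Complex.exp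
          (t * ((√n)⁻¹ * ∑ k ∈ Finset.range n, (f (orbit S x ζ k) - c) : ℝ) * Complex.I)
          ∂(Measure.infinitePi fun _ : ℕ => ℓ)) atTop
        (𝓝 (Real.exp (-(σ ^ 2 * t ^ 2 / 2)) : ℂ)) := by
  have := isCompact_iff_compactSpace.1 hKc
  have : Nonempty K := hK0.to_subtype
  obtain ⟨L, hL⟩ := hfL
  obtain ⟨A, hA⟩ := hfC
  set s := restrict hS hS' hE hK
  set h : C(K, ℝ) := ⟨fun x => f x, by have := hL.continuous; fun_prop⟩
  have hhL : LipschitzWith L h := fun x y => hL x y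
  obtain ⟨M, c, hM, hc⟩ := exists_norm_restrict_op_iterate_sub_const_le hS hS' hE hK hEℓ hC hq0 hq1
    hdecay ⟨L, hhL⟩
  have hgeom : Tendsto (fun n : ℕ => M * q ^ n) atTop (𝓝 0) := by
    simpa using (tendsto_pow_atTop_nhds_zero_of_lt_one hq0.le hq1).const_mul M
  have hconv : ∀ g : C(K, ℝ), ∃ c, Tendsto (fun n => (s.op ℓ ℝ)^[n] g) atTop
      (𝓝 (ContinuousMap.const K c)) := by
    refine s.exists_tendsto_op_iterate_const ℓ fun g hg => ?_
    obtain ⟨M, c, hM, hc⟩ := exists_norm_restrict_op_iterate_sub_const_le hS hS' hE hK hEℓ hC hq0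
      hq1 hdecay hg
    refine ⟨c, tendsto_iff_norm_sub_tendsto_zero.2 (squeeze_zero (fun _ => norm_nonneg _) hc ?_)⟩
    simpa using (tendsto_pow_atTop_nhds_zero_of_lt_one hq0.le hq1).const_mul M
  have hsum : Summable fun n => ‖(s.op ℓ ℝ)^[n] (h - ContinuousMap.const K c)‖ := by
    refine .of_nonneg_of_le (fun _ => norm_nonneg _) (fun n => ?_)
      ((summable_geometric_of_lt_one hq0.le hq1).mul_left M)
    rw [RandomMap.op_iterate_sub, RandomMap.op_iterate_const]
    exact hc n
  obtain ⟨σ, hσ⟩ := s.exists_tendsto_integral_exp ℓ hsum hconv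
  have hae : ∀ x : K, ∀ᵐ ζ ∂(Measure.infinitePi fun _ : ℕ => ℓ), ∀ n : ℕ,
      ∑ k ∈ Finset.range n, (h - ContinuousMap.const K c) (orbit s.toFun x ζ k) =
        ∑ k ∈ Finset.range n, (f (orbit S x ζ k) - c) := fun x => by
    filter_upwards [ae_forall_mem_infinitePi hEℓ] with ζ hζ n
    refine Finset.sum_congr rfl fun k _ => ?_
    rw [← coe_orbit_restrict hS hS' hE hK hζ]
    rfl
  refine ⟨c, σ, fun x hx => ⟨?_, ?_, fun t => ?_⟩⟩
  · refine tendsto_iff_norm_sub_tendsto_zero.2 (squeeze_zero (fun _ => norm_nonneg _)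
      (fun n => ?_) hgeom)
    rw [← op_restrict_iterate hS hS' hE hK hEℓ ⟨hL.continuous.measurable, A, hA⟩ (h := h)
      (fun _ => rfl) n ⟨x, hx⟩]
    exact (ContinuousMap.norm_coe_le_norm _ (⟨x, hx⟩ : K)).trans (hc n)
  · filter_upwards [s.ae_tendsto_average ℓ hsum ⟨x, hx⟩, hae ⟨x, hx⟩] with ζ h1 h2
    simpa only [h2] using h1
  · refine (hσ ⟨x, hx⟩ t).congr fun n => integral_congr_ae ?_
    filter_upwards [hae ⟨x, hx⟩] with ζ h2
    rw [h2 n]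

end Restrict


/-! ### Existence and uniqueness of the invariant measure -/

section Invariant

lemma continuous_orbit {X Z : Type*} [TopologicalSpace X] {S : X × Z → X}
    (hS : ∀ z, Continuous fun x => S (x, z))
    (ζ : ℕ → Z) (n : ℕ) : Continuous fun x => orbit S x ζ n := by
  induction n with
  | zero => exact continuous_id
  | succ n ih => exact (hS (ζ n)).comp ih

variable {X Z : Type*} [MeasurableSpace X] [MeasurableSpace Z] {S : X × Z → X} {ℓ : Measure Z}
  [IsProbabilityMeasure ℓ]

lemma lintegral_transition (hS : Measurable S) (μ : Measure X) [IsProbabilityMeasure μ] (n : ℕ)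
    {A : Set X} (hA : MeasurableSet A) :
    ∫⁻ x, transition S ℓ n x A ∂μ =
      (μ.prod (Measure.infinitePi fun _ : ℕ => ℓ)).map (fun p => orbit S p.1 p.2 n) A := by
  rw [Measure.map_apply (measurable_orbit hS n) hA,
    Measure.prod_apply (measurable_orbit hS n hA)]
  refine lintegral_congr fun x => ?_
  rw [transition, Measure.map_apply (measurable_orbit_right hS x n) hA]
  rfl

lemma isInvariant_iff (hS : Measurable S) (μ : Measure X) [IsProbabilityMeasure μ] :
    IsInvariant S ℓ μ ↔ ∀ n,
      (μ.prod (Measure.infinitePi fun _ : ℕ => ℓ)).map (fun p => orbit S p.1 p.2 n) = μ := by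
  refine forall_congr' fun n => ⟨fun h => ?_, fun h A hA => ?_⟩
  · ext A hA
    rw [← lintegral_transition hS μ n hA, h A hA]
  · rw [lintegral_transition hS μ n hA, h]

lemma integral_map_orbit (hS : Measurable S) (μ : Measure X) [IsProbabilityMeasure μ] (n : ℕ)
    {f : X → ℝ} (hf : BddMeasurable f) :
    ∫ y, f y ∂((μ.prod (Measure.infinitePi fun _ : ℕ => ℓ)).map fun p => orbit S p.1 p.2 n) =
      ∫ x, (markovOp S ℓ)^[n] f x ∂μ := by
  rw [integral_map (measurable_orbit hS n).aemeasurable hf.measurable.aestronglyMeasurable,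
    integral_prod _ (hf.integrable (measurable_orbit hS n))]
  simp_rw [integral_orbit hS ℓ hf]

lemma IsInvariant.integral_markovOp_iterate (hS : Measurable S) {μ : Measure X}
    [IsProbabilityMeasure μ] (hμ : IsInvariant S ℓ μ) (n : ℕ) {f : X → ℝ}
    (hf : BddMeasurable f) : ∫ x, (markovOp S ℓ)^[n] f x ∂μ = ∫ x, f x ∂μ := by
  rw [← integral_map_orbit hS μ n hf, (isInvariant_iff hS μ).1 hμ n]

variable [MetricSpace X] [BorelSpace X]

lemma continuous_markovOp_iterate (hS : Measurable S) (hS' : ∀ z, Continuous fun x => S (x, z))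
    {f : X → ℝ} (hfc : Continuous f) {C : ℝ} (hC : ∀ x, |f x| ≤ C) (n : ℕ) :
    Continuous ((markovOp S ℓ)^[n] f) := by
  have hf : BddMeasurable f := ⟨hfc.measurable, C, hC⟩
  have : (markovOp S ℓ)^[n] f =
      fun x => ∫ ζ, f (orbit S x ζ n) ∂(Measure.infinitePi fun _ : ℕ => ℓ) :=
    funext fun x => (integral_orbit hS ℓ hf n x).symm
  rw [this]
  exact continuous_of_dominated
    (fun x => (hf.integrable (measurable_orbit_right hS x n)).aestronglyMeasurable)
    (fun x => .of_forall fun ζ => hC _) (integrable_const C)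
    (.of_forall fun ζ => hfc.comp (continuous_orbit hS' ζ n))

/-- Bounded Lipschitz tests determine weak convergence, so the constant sequence `μ` converges to
`ν`, and weak limits are unique. -/
lemma ext_of_integral_lipschitz {μ ν : Measure X} [IsProbabilityMeasure μ]
    [IsProbabilityMeasure ν]
    (h : ∀ f : X → ℝ, (∃ K, LipschitzWith K f) → (∃ C, ∀ x, |f x| ≤ C) →
      ∫ x, f x ∂μ = ∫ x, f x ∂ν) : μ = ν := by
  let μ' : ProbabilityMeasure X := ⟨μ, ‹_›⟩
  let ν' : ProbabilityMeasure X := ⟨ν, ‹_›⟩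
  have hlim : Tendsto (fun _ : ℕ => μ') atTop (𝓝 ν') := by
    refine tendsto_iff_forall_lipschitz_integral_tendsto.2 fun f hfb hfl => ?_
    obtain ⟨C, hC⟩ := hfb
    have hb : ∃ C, ∀ x, |f x| ≤ C := by
      rcases isEmpty_or_nonempty X with h | ⟨⟨x₀⟩⟩
      · exact ⟨0, fun x => h.elim x⟩
      · refine ⟨C + |f x₀|, fun x => ?_⟩
        have h1 := hC x x₀
        rw [Real.dist_eq] at h1
        have h2 := abs_add_le (f x - f x₀) (f x₀)
        rw [sub_add_cancel] at h2
        linarith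
    have e : ∫ x, f x ∂(μ' : Measure X) = ∫ x, f x ∂(ν' : Measure X) := h f hfl hb
    rw [e]
    exact tendsto_const_nhds
  have he : μ' = ν' := tendsto_nhds_unique tendsto_const_nhds hlim
  exact congrArg (fun ρ : ProbabilityMeasure X => (ρ : Measure X)) he

/-- Existence of an invariant measure carried by a compact invariant set when the averages of
Lipschitz observables converge. -/
theorem exists_invariant_of_tendsto (hS : Measurable S)
    (hS' : ∀ z, Continuous fun x => S (x, z)) {K : Set X} (hK : IsCompact K) {z : X}
    (hz : ∀ n, ∀ᵐ y ∂(transition S ℓ n z), y ∈ K)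
    (hconv : ∀ f : X → ℝ, (∃ K, LipschitzWith K f) → (∃ C, ∀ x, |f x| ≤ C) →
      ∃ c, ∀ x, Tendsto (fun n => (markovOp S ℓ)^[n] f x) atTop (𝓝 c)) :
    ∃ μ : Measure X, IsProbabilityMeasure μ ∧ IsInvariant S ℓ μ ∧ (∀ᵐ y ∂μ, y ∈ K) ∧
      ∀ f : X → ℝ, (∃ K, LipschitzWith K f) → (∃ C, ∀ x, |f x| ≤ C) →
        ∀ x, Tendsto (fun n => (markovOp S ℓ)^[n] f x) atTop (𝓝 (∫ y, f y ∂μ)) := by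
  set p : ℕ → ProbabilityMeasure X := fun n =>
    ⟨transition S ℓ n z, isProbabilityMeasure_transition hS ℓ n z⟩ with hp
  -- Prokhorov with one compact set and no escaping mass; the limit point is taken along an
  -- ultrafilter, so no subsequence is needed.
  have hcomp : IsCompact {μ : ProbabilityMeasure X | ∀ _ : ℕ, μ Kᶜ ≤ 0} :=
    isCompact_setOfPred_probabilityMeasure_mass_eq_compl_isCompact_le
      (K := fun _ => K) (u := fun _ => 0) tendsto_const_nhds (fun _ => hK) (.inl inferInstance)
  obtain ⟨μ, hμK, hμ⟩ := hcomp.ultrafilter_le_nhds ((hyperfilter ℕ).map p) (by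
    rw [le_principal_iff, Ultrafilter.mem_coe, Ultrafilter.mem_map]
    refine Filter.univ_mem' fun n => fun _ => ?_
    have h1 : transition S ℓ n z Kᶜ = 0 := hz n
    rw [nonpos_iff_eq_zero, ProbabilityMeasure.coeFn_def]
    change (transition S ℓ n z Kᶜ).toNNReal = 0
    rw [h1]; rfl)
  have hlim : Tendsto p (hyperfilter ℕ) (𝓝 μ) := hμ
  have hint : ∀ f : X → ℝ, Continuous f → (∃ C, ∀ x, |f x| ≤ C) →
      Tendsto (fun N => (markovOp S ℓ)^[N] f z) (hyperfilter ℕ) (𝓝 (∫ y, f y ∂μ)) := by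
    rintro f hf ⟨C, hC⟩
    have h1 := ProbabilityMeasure.tendsto_iff_forall_integral_tendsto.1 hlim
      (BoundedContinuousFunction.ofNormedAddCommGroup f hf C hC)
    refine h1.congr fun N => ?_
    exact integral_transition hS ℓ ⟨hf.measurable, C, hC⟩ N z
  -- `∫ T^m f dμ` is a limit of `T^(n+m) f (z)`, hence does not depend on `m`: this is invariance.
  -- `T^m f` is used only as a continuous bounded test function.
  have hval : ∀ f : X → ℝ, (∃ K, LipschitzWith K f) → (∃ C, ∀ x, |f x| ≤ C) → ∀ m,
      ∀ x, Tendsto (fun n => (markovOp S ℓ)^[n] f x) atTop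
        (𝓝 (∫ y, (markovOp S ℓ)^[m] f y ∂μ)) := by
    rintro f hfl ⟨C, hC⟩ m x
    obtain ⟨c, hc⟩ := hconv f hfl ⟨C, hC⟩
    obtain ⟨L, hL⟩ := hfl
    have hb := BddMeasurable.markovOp_iterate hS ℓ (h := f) ⟨hL.continuous.measurable, C, hC⟩ m
    have h1 := hint _ (continuous_markovOp_iterate hS hS' hL.continuous hC m) hb.bdd
    have h2 : Tendsto (fun N => (markovOp S ℓ)^[N] ((markovOp S ℓ)^[m] f) z) atTop (𝓝 c) := by
      simp_rw [← Function.iterate_add_apply]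
      exact (tendsto_add_atTop_iff_nat m).2 (hc z)
    rw [tendsto_nhds_unique h1 (h2.mono_left Nat.hyperfilter_le_atTop)]
    exact hc x
  refine ⟨μ, inferInstance, ?_, ?_, fun f hfl hfb => hval f hfl hfb 0⟩
  · refine (isInvariant_iff hS _).2 fun n => ?_
    have := Measure.isProbabilityMeasure_map
      (μ := (μ : Measure X).prod (Measure.infinitePi fun _ : ℕ => ℓ))
      (measurable_orbit hS n).aemeasurable
    refine ext_of_integral_lipschitz fun f hfl hfb => ?_
    have hb : BddMeasurable f := ⟨hfl.choose_spec.continuous.measurable, hfb⟩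
    rw [integral_map_orbit hS _ n hb]
    exact tendsto_nhds_unique (hval f hfl hfb n z) (hval f hfl hfb 0 z)
  · have h1 := hμK 0
    rw [nonpos_iff_eq_zero, ProbabilityMeasure.null_iff_toMeasure_null] at h1
    exact h1

/-- By invariance `∫ f dν = ∫ T^n f dν`, and dominated convergence sends the right side to `∫ f dμ`.
-/
lemma IsInvariant.eq_of_tendsto (hS : Measurable S) {μ ν : Measure X} [IsProbabilityMeasure μ]
    [IsProbabilityMeasure ν] (hν : IsInvariant S ℓ ν)
    (hconv : ∀ f : X → ℝ, (∃ K, LipschitzWith K f) → (∃ C, ∀ x, |f x| ≤ C) →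
      ∀ x, Tendsto (fun n => (markovOp S ℓ)^[n] f x) atTop (𝓝 (∫ y, f y ∂μ))) : ν = μ := by
  refine ext_of_integral_lipschitz fun f hfl hfb => ?_
  obtain ⟨C, hC⟩ := hfb
  have hb : BddMeasurable f := ⟨hfl.choose_spec.continuous.measurable, C, hC⟩
  have h1 : Tendsto (fun n => ∫ x, (markovOp S ℓ)^[n] f x ∂ν) atTop
      (𝓝 (∫ _, (∫ y, f y ∂μ) ∂ν)) := by
    refine tendsto_integral_of_dominated_convergence (fun _ => C)
      (fun n => (hb.markovOp_iterate hS ℓ n).measurable.aestronglyMeasurable) (integrable_const C)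
      (fun n => .of_forall fun x => ?_) (.of_forall fun x => hconv f hfl ⟨C, hC⟩ x)
    rw [← integral_orbit hS ℓ hb]
    exact (norm_integral_le_of_norm_le_const (.of_forall fun ζ => hC _)).trans (by simp)
  simp_rw [hν.integral_markovOp_iterate hS _ hb] at h1
  simpa using tendsto_nhds_unique tendsto_const_nhds h1

end Invariant


/-! ### Limit theorems for all starting points -/

section Limit

variable {X : Type*} {Z : Type*}
  [MetricSpace X] [SecondCountableTopology X] [MeasurableSpace X] [BorelSpace X]
  [MetricSpace Z] [SecondCountableTopology Z] [MeasurableSpace Z] [BorelSpace Z]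
  {S : X × Z → X} {ℓ : Measure Z} [IsProbabilityMeasure ℓ] {Y : Set X}

/-- Limit theorems for orbits starting from an attainable set, with constants depending on the
attainable set. -/
theorem limit_theorems_on_attainableInf (hS : LocallyLipschitz S) (hℓ : IsCompact ℓ.support)
    (hAC : AsymptoticCompactness S ℓ.support Y) (hI : Irreducibility S ℓ Y)
    (hC : CouplingCondition S ℓ Y) (x₀ : X) {f : X → ℝ} (hfL : ∃ L, LipschitzWith L f)
    (hfC : ∃ C, ∀ x, |f x| ≤ C) :
    ∃ c : ℝ, ∃ σ : ℝ≥0, ∀ x ∈ attainableInf S ℓ.support (insert x₀ Y),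
      Tendsto (fun n => (markovOp S ℓ)^[n] f x) atTop (𝓝 c) ∧
      (∀ᵐ ζ ∂(Measure.infinitePi fun _ : ℕ => ℓ),
        Tendsto (fun n : ℕ => (n : ℝ)⁻¹ * ∑ k ∈ Finset.range n, (f (orbit S x ζ k) - c))
          atTop (𝓝 0)) ∧
      ∀ t : ℝ, Tendsto (fun n : ℕ => ∫ ζ, Complex.exp
          (t * ((√n)⁻¹ * ∑ k ∈ Finset.range n, (f (orbit S x ζ k) - c) : ℝ) * Complex.I)
          ∂(Measure.infinitePi fun _ : ℕ => ℓ)) atTop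
        (𝓝 (Real.exp (-(σ ^ 2 * t ^ 2 / 2)) : ℂ)) := by
  have hSc := hS.continuous
  have hSm := hSc.measurable
  have hS' : ∀ z, Continuous fun x => S (x, z) := fun z => by fun_prop
  have hE0 : ℓ.support.Nonempty := Measure.nonempty_support (IsProbabilityMeasure.ne_zero ℓ)
  have hEm : MeasurableSet ℓ.support := Measure.isClosed_support.measurableSet
  have hEℓ : ∀ᵐ z ∂ℓ, z ∈ ℓ.support := Measure.support_mem_ae
  have hY0 : Y.Nonempty := let ⟨z, hz, _⟩ := hI; ⟨z, hz⟩
  obtain ⟨C, q, hC0, hq0, hq1, hdecay⟩ := exists_exp_decay_osc hSm (fun n x hx =>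
    ae_transition_mem hEℓ hSm (fun x hx z hz => map_mem_attainableInf hSc hx hz)
      isClosed_closure.measurableSet n hx) hI hC
  set K := attainableInf S ℓ.support (insert x₀ Y) with hK
  have hKc : IsCompact K := hAC.isCompact_attainableInf hSc hℓ hE0 hY0 (hAC.1.insert x₀)
  have hKfwd : ∀ x ∈ K, ∀ z ∈ ℓ.support, S (x, z) ∈ K := fun x hx z hz =>
    map_mem_attainableInf hSc hx hz
  have hYK : Y ⊆ attainableInf S ℓ.support Y := subset_attainableInf hE0
  have hKK : attainableInf S ℓ.support Y ⊆ K := attainableInf_mono (Set.subset_insert _ _)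
  obtain ⟨L, hL⟩ := LocallyLipschitzOn.exists_lipschitzOnWith_of_compact (hKc.prod hℓ)
    (hS.locallyLipschitzOn (s := K ×ˢ ℓ.support))
  obtain ⟨hYc, κ, hκ, V, -, hV, hVb⟩ := hAC
  obtain ⟨M, hM⟩ := hV K hKc.isBounded
  obtain ⟨C', q', hC'0, hq'0, hq'1, hdecay'⟩ := exists_exp_decay_osc_of_attracted hEℓ hSm hKc hKfwd
    hL hYc hY0 (hYK.trans hKK) hκ (M := M)
    (fun x hx ζ hζ n hn => (hVb x ζ hζ n hn).trans (mul_le_mul_of_nonneg_right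
      (NNReal.coe_le_coe.2 (hM x hx)) (Real.exp_pos _).le)) hC0 hq0 hq1
    (fun f A hfm hfA hfl n x hx x' hx' => hdecay f A hfm hfA
      (fun y hy y' hy' => hfl y (hKK hy) y' (hKK hy')) n x (hYK hx) x' (hYK hx'))
  exact limit_theorems_of_exp_decay_osc hKc hSm hS' hEm hKfwd hEℓ hC'0 hq'0 hq'1 hdecay'
    (hY0.mono (hYK.trans hKK)) hfL hfC

/-- Limit theorems for orbits, with constants independent of the starting point. -/
theorem limit_theorems (hS : LocallyLipschitz S) (hℓ : IsCompact ℓ.support)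
    (hAC : AsymptoticCompactness S ℓ.support Y) (hI : Irreducibility S ℓ Y)
    (hC : CouplingCondition S ℓ Y) {f : X → ℝ} (hfL : ∃ L, LipschitzWith L f)
    (hfC : ∃ C, ∀ x, |f x| ≤ C) :
    ∃ c : ℝ, ∃ σ : ℝ≥0, ∀ x,
      Tendsto (fun n => (markovOp S ℓ)^[n] f x) atTop (𝓝 c) ∧
      (∀ᵐ ζ ∂(Measure.infinitePi fun _ : ℕ => ℓ),
        Tendsto (fun n : ℕ => (n : ℝ)⁻¹ * ∑ k ∈ Finset.range n, (f (orbit S x ζ k) - c))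
          atTop (𝓝 0)) ∧
      ∀ t : ℝ, Tendsto (fun n : ℕ => ∫ ζ, Complex.exp
          (t * ((√n)⁻¹ * ∑ k ∈ Finset.range n, (f (orbit S x ζ k) - c) : ℝ) * Complex.I)
          ∂(Measure.infinitePi fun _ : ℕ => ℓ)) atTop
        (𝓝 (Real.exp (-(σ ^ 2 * t ^ 2 / 2)) : ℂ)) := by
  obtain ⟨z, hz, -⟩ := id hI
  have hE0 : ℓ.support.Nonempty := Measure.nonempty_support (IsProbabilityMeasure.ne_zero ℓ)
  have hmem : ∀ x y, y ∈ insert x Y → y ∈ attainableInf S ℓ.support (insert x Y) :=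
    fun x y hy => subset_attainableInf hE0 hy
  obtain ⟨c, σ, h⟩ := limit_theorems_on_attainableInf hS hℓ hAC hI hC z hfL hfC
  refine ⟨c, σ, fun x => ?_⟩
  obtain ⟨c', σ', h'⟩ := limit_theorems_on_attainableInf hS hℓ hAC hI hC x hfL hfC
  -- The constants depend a priori on the compact set built from `x`. All these sets contain the
  -- same `z ∈ Y`, and uniqueness of limits there identifies `c`, then `σ` through the frequency `t
  -- = 1`.
  have hz1 := h z (hmem z z (Set.mem_insert _ _))
  have hz2 := h' z (hmem x z (Set.mem_insert_of_mem _ hz))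
  obtain rfl : c = c' := tendsto_nhds_unique hz1.1 hz2.1
  have hσ := tendsto_nhds_unique (hz1.2.2 1) (hz2.2.2 1)
  have hσ' : σ = σ' := by
    have h1 := Real.exp_injective (Complex.ofReal_injective hσ)
    have h2 : (σ : ℝ) ^ 2 = (σ' : ℝ) ^ 2 := by linarith
    exact NNReal.coe_injective ((sq_eq_sq₀ σ.2 σ'.2).1 h2)
  rw [hσ']
  exact h' x (hmem x x (Set.mem_insert _ _))

end Limit

end RDS

/-! ### Conclusion for the given i.i.d. noise -/

theorem mainTheorem8 {X : Type u} {Z : Type v}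
    [MetricSpace X] [PolishSpace X] [MeasurableSpace X] [BorelSpace X]
    [MetricSpace Z] [PolishSpace Z] [MeasurableSpace Z] [BorelSpace Z]
    (S : X × Z → X) (hS : LocallyLipschitz S)
    (ℓ : Measure Z) [IsProbabilityMeasure ℓ] (hℓ : IsCompact ℓ.support)
    (Y : Set X)
    (hAC : RDS.AsymptoticCompactness S ℓ.support Y)
    (hI : RDS.Irreducibility S ℓ Y)
    (hC : RDS.CouplingCondition.{u, v, w} S ℓ Y)
    {Ω : Type t} [MeasurableSpace Ω] (P : Measure Ω) [IsProbabilityMeasure P]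
    (ξ : ℕ → Ω → Z) (hξ_law : ∀ n, HasLaw (ξ n) ℓ P) (hξ_indep : iIndepFun ξ P) :
    ∃ μ : Measure X, IsProbabilityMeasure μ ∧ RDS.IsInvariant S ℓ μ ∧
      (∀ ν : Measure X, IsProbabilityMeasure ν → RDS.IsInvariant S ℓ ν → ν = μ) ∧
      IsCompact μ.support ∧
      (∀ f : X → ℝ, (∃ K, LipschitzWith K f) → (∃ C, ∀ x, |f x| ≤ C) →
        (∀ x : X, ∀ᵐ ω ∂P,
          Tendsto (fun n : ℕ => (n : ℝ)⁻¹ *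
              ∑ k ∈ Finset.range n, f (RDS.orbit S x (fun i => ξ i ω) k))
            atTop (𝓝 (∫ y, f y ∂μ))) ∧
        ∃ σ : ℝ≥0, ∀ x : X,
          TendstoInDistribution
            (fun (n : ℕ) ω => (√(n : ℝ))⁻¹ *
              ∑ k ∈ Finset.range n, (f (RDS.orbit S x (fun i => ξ i ω) k) - ∫ y, f y ∂μ))
            atTop (id : ℝ → ℝ) (fun _ => P) (gaussianReal 0 (σ ^ 2))) := by
  have hSc := hS.continuous
  have hSm := hSc.measurable
  have hE0 : ℓ.support.Nonempty := Measure.nonempty_support (IsProbabilityMeasure.ne_zero ℓ)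
  have hEℓ : ∀ᵐ z ∂ℓ, z ∈ ℓ.support := Measure.support_mem_ae
  obtain ⟨z, hz, -⟩ := id hI
  have hKc : IsCompact (RDS.attainableInf S ℓ.support Y) :=
    hAC.isCompact_attainableInf hSc hℓ hE0 ⟨z, hz⟩ hAC.1
  obtain ⟨μ, hμ, hinv, hμK, hconv⟩ := RDS.exists_invariant_of_tendsto hSm
    (fun z => by fun_prop) hKc
    (fun n => RDS.ae_transition_mem hEℓ hSm (fun x hx z hz => RDS.map_mem_attainableInf hSc hx hz)
      hKc.measurableSet n (RDS.subset_attainableInf hE0 hz))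
    (fun f hfL hfC => let ⟨c, _, h⟩ := RDS.limit_theorems hS hℓ hAC hI hC hfL hfC
      ⟨c, fun x => (h x).1⟩)
  refine ⟨μ, hμ, hinv, fun ν hν hνinv => hνinv.eq_of_tendsto hSm hconv,
    hKc.of_isClosed_subset Measure.isClosed_support
      (Measure.support_subset_of_isClosed hKc.isClosed hμK), fun f hfL hfC => ?_⟩
  obtain ⟨c, σ, h⟩ := RDS.limit_theorems hS hℓ hAC hI hC hfL hfC
  have hc : c = ∫ y, f y ∂μ := tendsto_nhds_unique (h z).1 (hconv f hfL hfC z)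
  rw [← hc]
  have hfm : Measurable f := hfL.choose_spec.continuous.measurable
  have hξm : AEMeasurable (fun ω i => ξ i ω) P :=
    aemeasurable_pi_iff.2 fun i => (hξ_law i).aemeasurable
  -- The noise sequence has the product law, so almost sure statements and characteristic functions
  -- transfer from the canonical space to `Ω`.
  have hlaw := hξ_indep.hasLaw_infinitePi hξ_law hξm
  refine ⟨fun x => ?_, σ, fun x => ?_⟩
  · have h1 := (h x).2.1
    rw [← hlaw.map_eq] at h1
    filter_upwards [ae_of_ae_map hξm h1] with ω hω
    have h2 := hω.add_const c
    rw [zero_add] at h2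
    refine h2.congr' ?_
    filter_upwards [eventually_gt_atTop 0] with n hn
    have hn' : (n : ℝ) ≠ 0 := by positivity
    rw [Finset.sum_sub_distrib, Finset.sum_const, Finset.card_range, nsmul_eq_mul]
    field_simp
    ring
  · have hsum : ∀ n : ℕ, Measurable fun ζ : ℕ → Z =>
        (√(n : ℝ))⁻¹ * ∑ k ∈ Finset.range n, (f (RDS.orbit S x ζ k) - c) := fun n =>
      (Finset.measurable_fun_sum _ fun k _ =>
        (hfm.comp (RDS.measurable_orbit_right hSm x k)).sub_const c).const_mul _
    have hsum' : ∀ n : ℕ, AEMeasurable (fun ω => (√(n : ℝ))⁻¹ *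
        ∑ k ∈ Finset.range n, (f (RDS.orbit S x (fun i => ξ i ω) k) - c)) P :=
      fun n => (hsum n).comp_aemeasurable hξm
    -- Lévy's continuity theorem reduces convergence in distribution to that of characteristic
    -- functions.
    refine ⟨hsum', by fun_prop,
      ProbabilityMeasure.tendsto_iff_tendsto_charFun.2 fun t => ?_⟩
    have hlimit : charFun ((gaussianReal 0 (σ ^ 2)).map id) t =
        (Real.exp (-(σ ^ 2 * t ^ 2 / 2)) : ℂ) := by
      rw [Measure.map_id, charFun_gaussianReal]
      push_cast
      congr 1
      ring
    change Tendsto _ _ (𝓝 (charFun ((gaussianReal 0 (σ ^ 2)).map id) t))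
    rw [hlimit]
    refine ((h x).2.2 t).congr fun n => ?_
    change _ = charFun (P.map _) t
    rw [charFun_apply_real, integral_map (hsum' n)
      (by fun_prop), ← hlaw.map_eq, integral_map hξm]
    exact (Complex.measurable_exp.comp (((Complex.measurable_ofReal.comp
        (hsum n)).const_mul _).mul_const _)).aestronglyMeasurable
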